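/- Let $(\mathcal R,\mu)$ and $(\mathcal S,\nu)$ be non-atomic $\sigma$-finite measure spaces, and let $1<p_0<q<\infty$, $1<p_1<\infty$, $1\le q_0\le\infty$ and $r=\frac{p_0q}{p_1(q-p_0)}$. For a measurable function $f$ let $f^*(t)=\inf\{\lambda\ge 0:\mu(\{|f|>\lambda\})\le t\}$, $t>0$, be its non-increasing rearrangement. For $1<p<\infty$ and $1\le s<\infty$ put $\|f\|_{L^{p,s}}=\bigl(\int_0^\infty t^{\frac sp-1}f^*(t)^s\,dt\bigr)^{1/s}$, and $\|f\|_{L^{p,\infty}}=\sup_{t>0}t^{1/p}f^*(t)$. Let $X=X(\mathcal R,\mu)$ and $Y=Y(\mathcal S,\nu)$ be rearrangement-invariant Banach function spaces (i.e. given by Banach function norms with the Fatou property, finite on characteristic functions of sets of finite measure, controlling the $L^1$-norm on each set of finite measure, and depending on $f$ only through $f^*$). Their representation spaces $\bar X$ on $(0,\mu(\mathcal R))$ and $\bar Y$ on $(0,\nu(\mathcal S))$, both intervals with Lebesgue measure, are given by $\|h\|_{\bar X}=\|f\|_X$ whenever $f^*=h^*$, and likewise for $\bar Y$. Assume that $X\subset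 (L^{p_0,q_0}+L^{q,1})(\mathcal R,\mu)$. Let $Y^{\langle p_1,q_0\rangle}$ be the space of all $\nu$-measurable $g$ with $$\|g\|_{Y^{\langle p_1,q_0\rangle}}=\Bigl\|t^{-\frac1{p_1}}\Bigl(\int_0^t s^{\frac{q_0}{p_1}-1}g^*(s)^{q_0}\,ds\Bigr)^{\frac1{q_0}}\Bigr\|_{\bar Y}<\infty ,$$ and for nonnegative measurable $f$ on $(0,\mu(\mathcal R))$ put $$R_{q_0}f(t)=t^{-\frac1{p_1}}\Bigl(\int_0^{t^r}s^{\frac{q_0}{p_0}-1}f^*(s)^{q_0}\,ds\Bigr)^{\frac1{q_0}},\qquad Sf(t)=\int_{t^r}^\infty s^{\frac1q-1}f^*(s)\,ds .$$ If $q_0=\infty$, the expressions $\bigl(\int_0^a s^{\frac{q_0}{p}-1}f^*(s)^{q_0}ds\bigr)^{1/q_0}$ are read as $\sup_{0<s\le a}s^{1/p}f^*(s)$. Consider operators $T$ defined on $(L^{p_0,q_0}+L^{q,1})(\mathcal R,\mu)$, with $\nu$-measurable functions as values (functions being identified when equal a.e.), that are bounded $$T\colon L^{p_0,q_0}(\mathcal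 R,\mu)\to L^{p_1,q_0}(\mathcal S,\nu)\quad\text{and}\quad T\colon L^{q,1}(\mathcal R,\mu)\to L^\infty(\mathcal S,\nu). \tag{$*$}$$ Such a $T$ is called quasilinear if there is a constant $k$ with $|T(f+g)|\le k(|Tf|+|Tg|)$ and $|T(cf)|=|c|\,|Tf|$ $\nu$-a.e. for all $f,g$ in its domain and all $c\in\mathbb R$. Then the following statements are equivalent. (i) Every linear operator satisfying $(*)$ is bounded from $X(\mathcal R,\mu)$ to $Y^{\langle p_1,q_0\rangle}(\mathcal S,\nu)$. (ii) Every quasilinear operator satisfying $(*)$ is bounded from $X(\mathcal R,\mu)$ to $Y^{\langle p_1,q_0\rangle}(\mathcal S,\nu)$. (iii) The operators $R_{q_0}$ and $S$ are bounded from $\bar X(0,\mu(\mathcal R))$ to $\bar Y(0,\nu(\mathcal S))$. -/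

import Mathlib

open MeasureTheory Filter Topology
open scoped ENNReal NNReal

noncomputable section

namespace CalderonLorentz

/-- `μ` is non-atomic: every measurable set of positive measure has a measurable subset which is
neither null nor of the same measure. (Mathlib's `NoAtoms` only says that points are null.) -/
def NonAtomic {α : Type*} [MeasurableSpace α] (μ : Measure α) : Prop :=
  ∀ A : Set α, MeasurableSet A → 0 < μ A →
    ∃ B : Set α, B ⊆ A ∧ MeasurableSet B ∧ 0 < μ B ∧ μ B < μ A

/-- The non-increasing rearrangement `f^*(t) = inf {λ ≥ 0 : μ {f > λ} ≤ t}`, used for `t > 0`. -/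
def rearr {α : Type*} [MeasurableSpace α] (μ : Measure α) (f : α → ℝ≥0∞) (t : ℝ) : ℝ≥0∞ :=
  sInf {l : ℝ≥0∞ | μ {x | l < f x} ≤ ENNReal.ofReal t}

/-- Rearrangement-invariant Banach function norms on the nonnegative (extended-valued)
`μ`-measurable functions. -/
structure RINorm {α : Type*} [MeasurableSpace α] (μ : Measure α) where
  /-- The functional; its values at non-measurable functions play no role. -/
  norm : (α → ℝ≥0∞) → ℝ≥0∞
  norm_eq_zero_iff : ∀ f, AEMeasurable f μ → (norm f = 0 ↔ f =ᵐ[μ] 0)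
  norm_smul : ∀ (a : ℝ≥0) (f), AEMeasurable f μ → norm (fun x => a * f x) = a * norm f
  norm_add_le : ∀ f g, AEMeasurable f μ → AEMeasurable g μ →
    norm (fun x => f x + g x) ≤ norm f + norm g
  norm_mono : ∀ f g, AEMeasurable f μ → AEMeasurable g μ → f ≤ᵐ[μ] g → norm f ≤ norm g
  /-- The Fatou property. -/
  norm_tendsto : ∀ (f : ℕ → α → ℝ≥0∞) (g : α → ℝ≥0∞), (∀ n, AEMeasurable (f n) μ) →
    AEMeasurable g μ → (∀ᵐ x ∂μ, Monotone fun n => f n x) →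
    (∀ᵐ x ∂μ, Tendsto (fun n => f n x) atTop (𝓝 (g x))) →
    Tendsto (fun n => norm (f n)) atTop (𝓝 (norm g))
  norm_indicator_lt_top : ∀ E, MeasurableSet E → μ E < ∞ → norm (E.indicator fun _ => 1) < ∞
  lintegral_le : ∀ E, MeasurableSet E → μ E < ∞ →
    ∃ C : ℝ≥0, ∀ f, AEMeasurable f μ → ∫⁻ x in E, f x ∂μ ≤ C * norm f
  norm_eq_of_rearr_eq : ∀ f g, AEMeasurable f μ → AEMeasurable g μ →
    (∀ t : ℝ, 0 < t → rearr μ f t = rearr μ g t) → norm f = norm g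

/-- Lebesgue measure on the interval `(0, μ(α))`. -/
def repMeasure {α : Type*} [MeasurableSpace α] (μ : Measure α) : Measure ℝ :=
  volume.restrict {t : ℝ | 0 < t ∧ ENNReal.ofReal t < μ Set.univ}

/-- The norm of the representation space on `(0, μ(α))`: the norm of `h` is the common value of
`X.norm f` over all `f` on the original space with `f^* = h^*`. By rearrangement invariance the
infimum is over at most one value; over a non-atomic σ-finite space such an `f` always exists. -/
def RINorm.repNorm {α : Type*} [MeasurableSpace α] {μ : Measure α} (X : RINorm μ)
    (h : ℝ → ℝ≥0∞) : ℝ≥0∞ :=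
  ⨅ (f : α → ℝ≥0∞) (_ : AEMeasurable f μ)
    (_ : ∀ t : ℝ, 0 < t → rearr μ f t = rearr (repMeasure μ) h t), X.norm f

/-- `(∫_I (s^(1/p) g(s))^q ds/s)^(1/q)` for `q < ∞`, and `sup_{s ∈ I} s^(1/p) g(s)` for `q = ∞`,
where `I` is a subset of `(0, ∞)`. -/
def lorentzFunctional (p : ℝ) (q : ℝ≥0∞) (I : Set ℝ) (g : ℝ → ℝ≥0∞) : ℝ≥0∞ :=
  if q = ∞ then ⨆ s ∈ I, ENNReal.ofReal (s ^ (1 / p)) * g s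
  else (∫⁻ s in I, ENNReal.ofReal (s ^ (q.toReal / p - 1)) * g s ^ q.toReal) ^ (1 / q.toReal)

/-- The Lorentz functional `‖f‖_{p,q}` for `0 < p < ∞`. -/
def lorentzNorm {α : Type*} [MeasurableSpace α] (μ : Measure α) (p : ℝ) (q : ℝ≥0∞)
    (f : α → ℝ) : ℝ≥0∞ :=
  lorentzFunctional p q (Set.Ioi 0) (rearr μ fun x => ‖f x‖ₑ)

/-- The functional of `Y^⟨p,q⟩`. -/
def RINorm.angleNorm {β : Type*} [MeasurableSpace β] {ν : Measure β} (Y : RINorm ν)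
    (p : ℝ) (q : ℝ≥0∞) (g : β → ℝ) : ℝ≥0∞ :=
  Y.repNorm fun t => ENNReal.ofReal (t ^ (-1 / p)) *
    lorentzFunctional p q (Set.Ioc 0 t) (rearr ν fun x => ‖g x‖ₑ)

/-- The exponent `r = p₀ q / (p₁ (q - p₀))`. -/
def slope (p₀ p₁ q : ℝ) : ℝ := p₀ * q / (p₁ * (q - p₀))

/-- `R_{q₀} f (t) = t^(-1/p₁) (∫_0^{t^r} s^(q₀/p₀ - 1) f^*(s)^{q₀} ds)^(1/q₀)` (a supremum if
`q₀ = ∞`); the rearrangement of `f` is taken with respect to the measure `m` on the half-line. -/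
def calderonR (m : Measure ℝ) (p₀ p₁ q : ℝ) (q₀ : ℝ≥0∞) (f : ℝ → ℝ≥0∞) (t : ℝ) : ℝ≥0∞ :=
  ENNReal.ofReal (t ^ (-1 / p₁)) *
    lorentzFunctional p₀ q₀ (Set.Ioc 0 (t ^ slope p₀ p₁ q)) (rearr m f)

/-- `S f (t) = ∫_{t^r}^∞ s^(1/q - 1) f^*(s) ds`. -/
def calderonS (m : Measure ℝ) (p₀ p₁ q : ℝ) (f : ℝ → ℝ≥0∞) (t : ℝ) : ℝ≥0∞ :=
  ∫⁻ s in Set.Ioi (t ^ slope p₀ p₁ q), ENNReal.ofReal (s ^ (1 / q - 1)) * rearr m f s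

/-- An operator on nonnegative functions is bounded between the representation spaces of `X`
and `Y`. -/
def BoundedRep {α β : Type*} [MeasurableSpace α] [MeasurableSpace β] {μ : Measure α}
    {ν : Measure β} (X : RINorm μ) (Y : RINorm ν) (A : (ℝ → ℝ≥0∞) → ℝ → ℝ≥0∞) : Prop :=
  ∃ C : ℝ≥0, ∀ f : ℝ → ℝ≥0∞, AEMeasurable f (repMeasure μ) → X.repNorm f < ∞ →
    Y.repNorm (A f) ≤ C * X.repNorm f

/-- Membership of (the class of) `f` in `L^{p₀,q₀} + L^{q,1}`. -/
def MemSum {α : Type*} [MeasurableSpace α] (μ : Measure α) (p₀ q : ℝ) (q₀ : ℝ≥0∞)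
    (f : α →ₘ[μ] ℝ) : Prop :=
  ∃ f₀ f₁ : α →ₘ[μ] ℝ, f = f₀ + f₁ ∧ lorentzNorm μ p₀ q₀ f₀ < ∞ ∧ lorentzNorm μ q 1 f₁ < ∞

/-- `T` is linear on the set `D` of functions (in use, `D` is a linear space). -/
def LinearOn {α β : Type*} [MeasurableSpace α] [MeasurableSpace β] {μ : Measure α}
    {ν : Measure β} (D : (α →ₘ[μ] ℝ) → Prop) (T : (α →ₘ[μ] ℝ) → (β →ₘ[ν] ℝ)) : Prop :=
  (∀ f g, D f → D g → T (f + g) = T f + T g) ∧ ∀ (c : ℝ) (f), D f → T (c • f) = c • T f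

/-- `T` is quasilinear on the set `D` of functions: `|T(f+g)| ≤ k (|Tf| + |Tg|)` and
`|T(cf)| = |c| |Tf|` almost everywhere. -/
def QuasilinearOn {α β : Type*} [MeasurableSpace α] [MeasurableSpace β] {μ : Measure α}
    {ν : Measure β} (D : (α →ₘ[μ] ℝ) → Prop) (T : (α →ₘ[μ] ℝ) → (β →ₘ[ν] ℝ)) : Prop :=
  (∃ k : ℝ, ∀ f g, D f → D g → ∀ᵐ y ∂ν, |T (f + g) y| ≤ k * (|T f y| + |T g y|)) ∧
    ∀ (c : ℝ) (f), D f → ∀ᵐ y ∂ν, |T (c • f) y| = |c| * |T f y|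

/-- `T : L^{p₀,q₀} → L^{p₁,q₁}` and `T : L^{q,1} → L^∞` boundedly. -/
def EndpointBounded {α β : Type*} [MeasurableSpace α] [MeasurableSpace β] {μ : Measure α}
    {ν : Measure β} (p₀ p₁ q : ℝ) (q₀ q₁ : ℝ≥0∞) (T : (α →ₘ[μ] ℝ) → (β →ₘ[ν] ℝ)) : Prop :=
  (∃ C : ℝ≥0, ∀ f : α →ₘ[μ] ℝ, lorentzNorm μ p₀ q₀ f < ∞ →
    lorentzNorm ν p₁ q₁ (T f) ≤ C * lorentzNorm μ p₀ q₀ f) ∧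
  ∃ C : ℝ≥0, ∀ f : α →ₘ[μ] ℝ, lorentzNorm μ q 1 f < ∞ →
    eLpNorm (T f) ∞ ν ≤ C * lorentzNorm μ q 1 f

/-- `T` is bounded from `X` to `Y^⟨p,q⟩`. -/
def BoundedToAngle {α β : Type*} [MeasurableSpace α] [MeasurableSpace β] {μ : Measure α}
    {ν : Measure β} (X : RINorm μ) (Y : RINorm ν) (p : ℝ) (q : ℝ≥0∞)
    (T : (α →ₘ[μ] ℝ) → (β →ₘ[ν] ℝ)) : Prop :=
  ∃ C : ℝ≥0, ∀ f : α →ₘ[μ] ℝ, X.norm (fun x => ‖f x‖ₑ) < ∞ →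
    Y.angleNorm p q (T f) ≤ C * X.norm fun x => ‖f x‖ₑ

end CalderonLorentz

end

/-! Upper bound, (iii) to (ii). Put a = t^r and split f at the level f^*(a). The upper part lives on
a set of measure at most a, and its L^{p₀,q₀} norm is at most the integral in R f(t). The lower part
has L^{q,1} norm at most q a^{1/q} f^*(a) plus S f(t). The exponent r is the one with r/p₀ = 1/p₁ +
r/q, so a^{1/q} f^*(a) is absorbed by R f(t). The two endpoint bounds then dominate the average of
(T f)^* over (0,t) by R f + S f pointwise (`angle_le_calderon`), and the norm of Y preserves this.

Lower bound, (i) to (iii). One linear operator suffices: `kernelOp`, with kernel (σ(x) +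
τ(y)^r)^{1/q-1}, where σ and τ are measure preserving maps onto the representation intervals. By the
Hardy–Littlewood inequality |T g(y)| is at most `stieltjes` of g^* at τ(y)^r. The value at 0 of that
integral is the L^{q,1} norm, and a Hardy type inequality (`lorentzFunctional_stieltjes_le`) gives
the other endpoint. For g = f^* ∘ σ equality holds. The integral at a controls both its tail beyond
a, which is S, and a^{1/q} f^*(a), whose Lorentz average is R after the substitution s = u^r
(`calderon_le_angle`).

The maps σ and τ exist because a maximal chain of sets of finite measure in a non-atomic space takes
all intermediate measures (`exists_mem_measure_eq`). -/

namespace CalderonLorentz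

/-! ### Maximal chains of sets of finite measure, ordered by almost everywhere inclusion. -/

section Chains

variable {α : Type*} [MeasurableSpace α] {μ : Measure α}

/-- Measurable sets of finite measure. -/
abbrev FinSet (μ : Measure α) : Type _ := {s : Set α // MeasurableSet s ∧ μ s < ∞}

/-- Inclusion up to a null set. -/
def FinSet.aeSub (s t : FinSet μ) : Prop := s.1 ≤ᵐ[μ] t.1

lemma aeSub_total {M : Set (FinSet μ)} (hM : IsMaxChain FinSet.aeSub M) {s t : FinSet μ}
    (hs : s ∈ M) (ht : t ∈ M) : s.1 ≤ᵐ[μ] t.1 ∨ t.1 ≤ᵐ[μ] s.1 := by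
  by_cases h : s = t
  · subst h; exact Or.inl (EventuallyLE.refl _ _)
  · exact hM.1 hs ht h

/-- Inside a chain the order is the order of the measures: a reverse inclusion between sets of
finite measure becomes equality almost everywhere. -/
lemma aeSub_of_measure_le {M : Set (FinSet μ)} (hM : IsMaxChain FinSet.aeSub M) {s t : FinSet μ}
    (hs : s ∈ M) (ht : t ∈ M) (h : μ s.1 ≤ μ t.1) : s.1 ≤ᵐ[μ] t.1 := by
  rcases aeSub_total hM hs ht with h' | h'
  · exact h'
  · exact (ae_eq_of_ae_subset_of_measure_ge h' h t.2.1.nullMeasurableSet s.2.2.ne).symm.le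

/-- Maximality is used only in this form: a set comparable with the whole chain already belongs to
it. -/
lemma mem_of_aeSub_total {M : Set (FinSet μ)} (hM : IsMaxChain FinSet.aeSub M) {s : FinSet μ}
    (hs : ∀ t ∈ M, s.1 ≤ᵐ[μ] t.1 ∨ t.1 ≤ᵐ[μ] s.1) : s ∈ M := by
  have : M = insert s M := hM.2 (hM.1.insert fun t ht _ => hs t ht) (Set.subset_insert _ _)
  rw [this]; exact Set.mem_insert _ _

/-- A maximal chain of sets of finite measure has a greatest element among those of measure at
most `c`, up to null sets. -/
lemma exists_lower_mem {M : Set (FinSet μ)} (hM : IsMaxChain FinSet.aeSub M) {c : ℝ≥0∞}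
    (hc : c < ∞) :
    ∃ U ∈ M, μ U.1 ≤ c ∧ ∀ D ∈ M, μ D.1 ≤ c → D.1 ≤ᵐ[μ] U.1 := by
  let S : Set ℝ≥0∞ := {x | ∃ C ∈ M, μ C.1 = x ∧ x ≤ c}
  have hempty : (⟨∅, MeasurableSet.empty, by simp⟩ : FinSet μ) ∈ M :=
    mem_of_aeSub_total hM fun t _ => Or.inl (by
      exact LE.le.eventuallyLE (Set.empty_subset _))
  have hne : S.Nonempty := ⟨0, _, hempty, by simp, by simp⟩
  obtain ⟨u, humono, hulim, hu⟩ := exists_seq_tendsto_sSup hne (OrderTop.bddAbove S)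
  choose C hCM hCu huc using hu
  have hmeas : MeasurableSet (⋃ n, (C n).1) := MeasurableSet.iUnion fun n => (C n).2.1
  have hacc : ∀ n, μ (Set.accumulate (fun n => (C n).1) n) ≤ c := by
    intro n
    refine (measure_mono_ae ?_).trans ((hCu n).le.trans (huc n))
    have : ∀ᵐ x ∂μ, ∀ k, k ≤ n → x ∈ (C k).1 → x ∈ (C n).1 := by
      rw [ae_all_iff]; intro k
      by_cases hk : k ≤ n
      · filter_upwards [aeSub_of_measure_le hM (hCM k) (hCM n)
          (by rw [hCu, hCu]; exact humono hk)] with x hx _ h using hx h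
      · exact Eventually.of_forall fun x h => absurd h hk
    filter_upwards [this] with x hx h
    obtain ⟨k, hk, hxk⟩ := Set.mem_accumulate.1 h
    exact hx k hk hxk
  have hUc : μ (⋃ n, (C n).1) ≤ c := by
    rw [measure_iUnion_eq_iSup_accumulate]
    exact iSup_le hacc
  let U : FinSet μ := ⟨⋃ n, (C n).1, hmeas, hUc.trans_lt hc⟩
  have hle : ∀ D ∈ M, (∀ n, μ (C n).1 ≤ μ D.1) → U.1 ≤ᵐ[μ] D.1 := by
    intro D hD h
    have : ∀ᵐ x ∂μ, ∀ k, x ∈ (C k).1 → x ∈ D.1 := by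
      rw [ae_all_iff]; intro k
      exact aeSub_of_measure_le hM (hCM k) hD (h k)
    filter_upwards [this] with x hx h
    obtain ⟨k, hk⟩ := Set.mem_iUnion.1 h
    exact hx k hk
  have hUM : U ∈ M := by
    -- Either some C n has at least the measure of D, and then D lies below the union, or D lies
    -- above every C n.
    refine mem_of_aeSub_total hM fun D hD => ?_
    by_cases h : ∃ n, μ D.1 ≤ μ (C n).1
    · obtain ⟨n, hn⟩ := h
      refine Or.inr ((aeSub_of_measure_le hM hD (hCM n) hn).trans ?_)
      exact LE.le.eventuallyLE (Set.subset_iUnion (fun n => (C n).1) n)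
    · push Not at h
      exact Or.inl (hle D hD fun n => (h n).le)
  refine ⟨U, hUM, hUc, fun D hD hDc => aeSub_of_measure_le hM hD hUM ?_⟩
  have h1 : μ D.1 ≤ sSup S := le_sSup ⟨D, hD, rfl, hDc⟩
  refine h1.trans (le_of_tendsto' hulim fun n => ?_)
  rw [← hCu n]
  exact measure_mono (Set.subset_iUnion (fun n => (C n).1) n)

/-- A lower bound, of measure at least `c`, of the elements of measure at least `c` in a maximal
chain. -/
lemma exists_upper_set {M : Set (FinSet μ)} (hM : IsMaxChain FinSet.aeSub M) {c : ℝ≥0∞}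
    {E : FinSet μ} (hE : E ∈ M) (hcE : c ≤ μ E.1) :
    ∃ V : FinSet μ, c ≤ μ V.1 ∧ ∀ D ∈ M, c ≤ μ D.1 → V.1 ≤ᵐ[μ] D.1 := by
  let S : Set ℝ≥0∞ := {x | ∃ C ∈ M, μ C.1 = x ∧ c ≤ x}
  have hne : S.Nonempty := ⟨_, E, hE, rfl, hcE⟩
  obtain ⟨u, humono, hulim, hu⟩ := exists_seq_tendsto_sInf hne (OrderBot.bddBelow S)
  choose C hCM hCu huc using hu
  have hsub : ∀ n, (⋂ n, (C n).1) ⊆ (C n).1 := fun n => Set.iInter_subset _ n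
  let V : FinSet μ := ⟨⋂ n, (C n).1, MeasurableSet.iInter fun n => (C n).2.1,
    (measure_mono (hsub 0)).trans_lt (C 0).2.2⟩
  have hV : μ V.1 = ⨅ n, μ (⋂ j ≤ n, (C j).1) :=
    measure_iInter_eq_iInf_measure_iInter_le (fun n => (C n).2.1.nullMeasurableSet)
      ⟨0, (C 0).2.2.ne⟩
  have hpart : ∀ n, u n ≤ μ (⋂ j ≤ n, (C j).1) := by
    intro n
    rw [← hCu n]
    refine measure_mono_ae ?_
    have : ∀ᵐ x ∂μ, ∀ k, k ≤ n → x ∈ (C n).1 → x ∈ (C k).1 := by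
      rw [ae_all_iff]; intro k
      by_cases hk : k ≤ n
      · filter_upwards [aeSub_of_measure_le hM (hCM n) (hCM k)
          (by rw [hCu, hCu]; exact humono hk)] with x hx _ h using hx h
      · exact Eventually.of_forall fun x h => absurd h hk
    filter_upwards [this] with x hx h
    exact Set.mem_iInter₂.2 fun k hk => hx k hk h
  refine ⟨V, ?_, ?_⟩
  · rw [hV]; exact le_iInf fun n => (huc n).trans (hpart n)
  · intro D hD hcD
    by_cases h : ∃ n, μ (C n).1 ≤ μ D.1
    · obtain ⟨n, hn⟩ := h
      exact (LE.le.eventuallyLE (hsub n)).trans (aeSub_of_measure_le hM (hCM n) hD hn)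
    · push Not at h
      have hVD : μ V.1 ≤ μ D.1 := by
        have h1 : sInf S ≤ μ D.1 := sInf_le ⟨D, hD, rfl, hcD⟩
        refine le_trans ?_ h1
        exact ge_of_tendsto' hulim fun n => by rw [← hCu n]; exact measure_mono (hsub n)
      have hDV : D.1 ≤ᵐ[μ] V.1 := by
        have : ∀ᵐ x ∂μ, ∀ k, x ∈ D.1 → x ∈ (C k).1 := by
          rw [ae_all_iff]; intro k
          exact aeSub_of_measure_le hM hD (hCM k) (h k).le
        filter_upwards [this] with x hx h
        exact Set.mem_iInter.2 fun k => hx k h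
      exact (ae_eq_of_ae_subset_of_measure_ge hDV hVD D.2.1.nullMeasurableSet V.2.2.ne).symm.le

/-- Over a non-atomic measure, the measures of the elements of a maximal chain fill an interval. -/
lemma exists_mem_measure_eq (hμ : NonAtomic μ) {M : Set (FinSet μ)}
    (hM : IsMaxChain FinSet.aeSub M) {c : ℝ≥0∞} {E : FinSet μ} (hE : E ∈ M) (hcE : c ≤ μ E.1) :
    ∃ C ∈ M, μ C.1 = c := by
  obtain ⟨U, hU, hUc, hUmax⟩ := exists_lower_mem hM (hcE.trans_lt E.2.2)
  obtain ⟨V, hVc, hVmin⟩ := exists_upper_set hM hE hcE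
  by_contra hno
  push Not at hno
  have hlt : μ U.1 < c := lt_of_le_of_ne hUc (hno U hU)
  have hpos : 0 < μ (V.1 \ U.1) := by
    refine lt_of_lt_of_le (tsub_pos_of_lt (hlt.trans_le hVc)) le_measure_sdiff
  -- If c were skipped, the gap V \ U would have positive measure, hence a proper part B. Then U ∪ B
  -- is comparable with the chain and so belongs to it. It cannot have measure below c, so it
  -- contains V, which forces V \ U into B.
  obtain ⟨B, hBs, hBm, hB0, hBlt⟩ := hμ _ (V.2.1.diff U.2.1) hpos
  have hBfin : μ B < ∞ := (measure_mono (hBs.trans Set.sdiff_subset)).trans_lt V.2.2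
  have hdisj : Disjoint U.1 B := Set.disjoint_left.2 fun x hx hxB => (hBs hxB).2 hx
  have hW : μ (U.1 ∪ B) = μ U.1 + μ B := measure_union hdisj hBm
  let W : FinSet μ := ⟨U.1 ∪ B, U.2.1.union hBm, by
    rw [hW]; exact ENNReal.add_lt_top.2 ⟨U.2.2, hBfin⟩⟩
  have hWM : W ∈ M := by
    refine mem_of_aeSub_total hM fun D hD => ?_
    rcases le_total (μ D.1) c with h | h
    · exact Or.inr ((hUmax D hD h).trans (LE.le.eventuallyLE Set.subset_union_left))
    · left
      filter_upwards [hVmin D hD h, aeSub_of_measure_le hM hU hD (hUc.trans h)] with x h1 h2 hx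
      rcases hx with hx | hx
      · exact h2 hx
      · exact h1 (hBs hx).1
  have hWc : c ≤ μ W.1 := by
    by_contra hcon
    have h1 : μ W.1 ≤ μ U.1 := measure_mono_ae (hUmax W hWM (not_le.1 hcon).le)
    have h2 : μ U.1 < μ W.1 := by
      change _ < μ (U.1 ∪ B)
      rw [hW]; exact ENNReal.lt_add_right U.2.2.ne hB0.ne'
    exact absurd h1 (not_le.2 h2)
  have hVW : V.1 ≤ᵐ[μ] W.1 := hVmin W hWM hWc
  have : μ (V.1 \ U.1) ≤ μ B := by
    refine measure_mono_ae ?_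
    filter_upwards [hVW] with x h1 hx
    rcases h1 hx.1 with h | h
    · exact absurd h hx.2
    · exact h
  exact absurd this (not_le.2 hBlt)

end Chains

/-! ### Measure preserving maps onto the representation interval. -/

lemma volume_pos_ofReal_lt (D : ℝ≥0∞) : volume {s : ℝ | 0 < s ∧ ENNReal.ofReal s < D} = D := by
  rcases eq_or_ne D ∞ with rfl | hD
  · have : {s : ℝ | 0 < s ∧ ENNReal.ofReal s < ∞} = Set.Ioi 0 := by
      ext s; simp
    rw [this, Real.volume_Ioi]
  · have : {s : ℝ | 0 < s ∧ ENNReal.ofReal s < D} = Set.Ioo 0 D.toReal := by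
      ext s
      simp only [Set.mem_ofPred_eq, Set.mem_Ioo]
      refine and_congr_right fun hs => ?_
      rw [ENNReal.ofReal_lt_iff_lt_toReal hs.le hD]
    rw [this, Real.volume_Ioo, sub_zero, ENNReal.ofReal_toReal hD]

lemma measurableSet_repInterval (D : ℝ≥0∞) :
    MeasurableSet {s : ℝ | 0 < s ∧ ENNReal.ofReal s < D} :=
  measurableSet_Ioi.inter (measurableSet_lt ENNReal.measurable_ofReal measurable_const)

section MeasurePreserving

variable {α : Type*} [MeasurableSpace α] {μ : Measure α}

/-- A non-atomic σ-finite space carries a measurable `[0, ∞]`-valued function which is uniformly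
distributed over `(0, μ(α))`. -/
lemma exists_uniform_ennreal [SigmaFinite μ] (hμ : NonAtomic μ) :
    ∃ φ : α → ℝ≥0∞, Measurable φ ∧ (∀ᵐ x ∂μ, φ x < ∞) ∧
      ∀ t : ℝ, μ {x | φ x < ENNReal.ofReal t} = min (ENNReal.ofReal t) (μ Set.univ) := by
  classical
  -- The chain is grown from an exhausting sequence, so its measures reach every value below the
  -- total mass, finite or not.
  let E : ℕ → FinSet μ := fun n =>
    ⟨spanningSets μ n, measurableSet_spanningSets μ n, measure_spanningSets_lt_top μ n⟩
  have hchain : IsChain FinSet.aeSub (Set.range E) := by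
    rintro _ ⟨m, rfl⟩ _ ⟨n, rfl⟩ _
    rcases le_total m n with h | h
    · exact Or.inl (LE.le.eventuallyLE (monotone_spanningSets μ h))
    · exact Or.inr (LE.le.eventuallyLE (monotone_spanningSets μ h))
  obtain ⟨M, hM, hEM⟩ := hchain.exists_maxChain
  have hsup : μ Set.univ = ⨆ n, μ (spanningSets μ n) := by
    rw [← iUnion_spanningSets μ, (monotone_spanningSets μ).measure_iUnion]
  have hex : ∀ c : ℝ≥0∞, c < μ Set.univ → ∃ C ∈ M, μ C.1 = c := by
    intro c hc
    rw [hsup, lt_iSup_iff] at hc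
    obtain ⟨n, hn⟩ := hc
    exact exists_mem_measure_eq hμ hM (hEM ⟨n, rfl⟩) hn.le
  -- Rational levels keep the family countable: the infimum below is measurable, and the almost
  -- everywhere inclusions hold simultaneously.
  let J := {c : ℚ // ENNReal.ofReal c < μ Set.univ}
  choose C hCM hC using fun c : J => hex _ c.2
  let φ : α → ℝ≥0∞ := fun x => ⨅ c : J, if x ∈ (C c).1 then ENNReal.ofReal (c.1 : ℝ) else ∞
  have hφ : Measurable φ := by
    refine Measurable.iInf fun c => ?_
    exact Measurable.ite (C c).2.1 measurable_const measurable_const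
  have hlt : ∀ x (b : ℝ≥0∞), b ≠ 0 → (φ x < b ↔ ∃ c : J, ENNReal.ofReal (c.1 : ℝ) < b ∧
      x ∈ (C c).1) := by
    intro x b hb
    simp only [φ, iInf_lt_iff]
    refine exists_congr fun c => ?_
    by_cases hx : x ∈ (C c).1 <;> simp [hx]
  have hmono : ∀ c : J, ∀ D ∈ M, ENNReal.ofReal (c.1 : ℝ) ≤ μ D.1 → (C c).1 ≤ᵐ[μ] D.1 :=
    fun c D hD h => aeSub_of_measure_le hM (hCM c) hD (by rwa [hC])
  have hdist : ∀ t : ℝ, μ {x | φ x < ENNReal.ofReal t} = min (ENNReal.ofReal t) (μ Set.univ) := by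
    intro t
    rcases le_or_gt t 0 with ht | ht
    · simp [ENNReal.ofReal_of_nonpos ht]
    have ht0 : ENNReal.ofReal t ≠ 0 := by simpa using ht
    apply le_antisymm
    · refine le_min ?_ (measure_mono (Set.subset_univ _))
      rcases lt_or_ge (ENNReal.ofReal t) (μ Set.univ) with h | h
      · obtain ⟨D, hD, hDt⟩ := hex _ h
        rw [← hDt]
        refine measure_mono_ae ?_
        have : ∀ᵐ x ∂μ, ∀ c : J, ENNReal.ofReal (c.1 : ℝ) < ENNReal.ofReal t →
            x ∈ (C c).1 → x ∈ D.1 := by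
          rw [ae_all_iff]; intro c
          by_cases hc : ENNReal.ofReal (c.1 : ℝ) < ENNReal.ofReal t
          · filter_upwards [hmono c D hD (by rw [hDt]; exact hc.le)] with x hx _ h using hx h
          · exact Eventually.of_forall fun x h => absurd h hc
        filter_upwards [this] with x hx h
        obtain ⟨c, hc, hxc⟩ := (hlt _ _ ht0).1 (hDt ▸ h : φ x < ENNReal.ofReal t)
        exact hx c hc hxc
      · exact (measure_mono (Set.subset_univ _)).trans h
    · refine le_of_forall_lt fun l hl => ?_
      obtain ⟨c, hc0, hlc, hc⟩ := ENNReal.lt_iff_exists_rat_btwn.1 hl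
      have hcJ : ENNReal.ofReal (c : ℝ) < μ Set.univ := hc.trans_le (min_le_right _ _)
      refine hlc.trans_le ?_
      change ENNReal.ofReal (c : ℝ) ≤ _
      rw [← hC ⟨c, hcJ⟩]
      refine measure_mono fun x hx => ?_
      rw [Set.mem_ofPred_eq, hlt _ _ ht0]
      exact ⟨⟨c, hcJ⟩, hc.trans_le (min_le_left _ _), hx⟩
  refine ⟨φ, hφ, ?_, hdist⟩
  -- With infinite mass, each spanning set lies in a chain set of larger rational measure. With
  -- finite mass, the distribution formula at the total mass already shows that `φ` is finite almost
  -- everywhere.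
  by_cases hfin : μ Set.univ = ∞
  · have : ∀ᵐ x ∂μ, ∀ n, x ∈ spanningSets μ n → φ x < ∞ := by
      rw [ae_all_iff]; intro n
      have h1 : μ (spanningSets μ n) < ∞ := measure_spanningSets_lt_top μ n
      obtain ⟨c, -, hc1, hc2⟩ := ENNReal.lt_iff_exists_rat_btwn.1 h1
      have hcJ : ENNReal.ofReal (c : ℝ) < μ Set.univ := by rw [hfin]; exact hc2
      have := aeSub_of_measure_le hM (hEM ⟨n, rfl⟩) (hCM ⟨c, hcJ⟩) (by
        rw [hC]; exact hc1.le)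
      filter_upwards [this] with x hx h
      rw [hlt _ _ ENNReal.top_ne_zero]
      exact ⟨⟨c, hcJ⟩, ENNReal.ofReal_lt_top, hx h⟩
    filter_upwards [this] with x hx
    obtain ⟨n, hn⟩ := Set.mem_iUnion.1 ((iUnion_spanningSets μ).symm ▸ Set.mem_univ x)
    exact hx n hn
  · have h1 := hdist ((μ Set.univ).toReal)
    rw [ENNReal.ofReal_toReal hfin, min_self] at h1
    have hms : MeasurableSet {x | φ x < μ Set.univ} := measurableSet_lt hφ measurable_const
    have h2 : μ {x | φ x < μ Set.univ}ᶜ = 0 := by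
      rw [measure_compl hms (h1.trans_lt (lt_top_iff_ne_top.2 hfin)).ne, h1, tsub_self]
    have h3 : ∀ᵐ x ∂μ, φ x < μ Set.univ := h2
    filter_upwards [h3] with x hx using hx.trans_le le_top

/-- A non-atomic σ-finite space has a measure preserving map onto the interval `(0, μ(α))`. -/
theorem exists_measurePreserving [SigmaFinite μ] (hμ : NonAtomic μ) :
    ∃ σ : α → ℝ, MeasurePreserving σ μ (repMeasure μ) := by
  obtain ⟨φ, hφ, hfin, hdist⟩ := exists_uniform_ennreal hμ
  have hσ : Measurable fun x => (φ x).toReal := hφ.ennreal_toReal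
  have hrep : ∀ t : ℝ, repMeasure μ (Set.Iio t) = min (ENNReal.ofReal t) (μ Set.univ) := by
    intro t
    rw [repMeasure, Measure.restrict_apply measurableSet_Iio,
      ← volume_pos_ofReal_lt (min (ENNReal.ofReal t) (μ Set.univ))]
    congr 1
    ext s
    simp only [Set.mem_inter_iff, Set.mem_Iio, Set.mem_ofPred_eq, lt_min_iff]
    constructor
    · rintro ⟨h1, h2, h3⟩
      exact ⟨h2, (ENNReal.ofReal_lt_ofReal_iff_of_nonneg h2.le).2 h1, h3⟩
    · rintro ⟨h1, h2, h3⟩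
      exact ⟨(ENNReal.ofReal_lt_ofReal_iff_of_nonneg h1.le).1 h2, h1, h3⟩
  have hmap : ∀ t : ℝ, μ.map (fun x => (φ x).toReal) (Set.Iio t) =
      min (ENNReal.ofReal t) (μ Set.univ) := by
    intro t
    rw [Measure.map_apply hσ measurableSet_Iio, ← hdist t]
    refine measure_congr ?_
    filter_upwards [hfin] with x hx
    refine propext ?_
    change (φ x).toReal < t ↔ φ x < ENNReal.ofReal t
    exact (ENNReal.lt_ofReal_iff_toReal_lt hx.ne).symm
  refine ⟨_, hσ, ?_⟩
  refine Measure.ext_of_generateFrom_of_iUnion (Set.range Set.Iio) (fun n : ℕ => Set.Iio (n : ℝ))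
    ?_ isPiSystem_Iio ?_ (fun n => ⟨_, rfl⟩) ?_ ?_
  · rw [← borel_eq_generateFrom_Iio]; exact BorelSpace.measurable_eq
  · refine Set.iUnion_eq_univ_iff.2 fun x => ?_
    obtain ⟨n, hn⟩ := exists_nat_gt x
    exact ⟨n, hn⟩
  · intro n
    rw [hmap]
    exact ((min_le_left _ _).trans_lt ENNReal.ofReal_lt_top).ne
  · rintro _ ⟨t, rfl⟩
    rw [hmap, hrep]

end MeasurePreserving

/-! ### Rearrangements and the representation norm. -/

section Rearrangement

variable {α β : Type*} [MeasurableSpace α] [MeasurableSpace β] {μ : Measure α} {ν : Measure β}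

/-- The infimum is attained, because the distribution function is continuous from the right in the
level. -/
lemma rearr_le_iff {f : α → ℝ≥0∞} {t : ℝ} {l : ℝ≥0∞} :
    rearr μ f t ≤ l ↔ μ {x | l < f x} ≤ ENNReal.ofReal t := by
  refine ⟨fun h => ?_, fun h => sInf_le h⟩
  rcases eq_or_ne l ∞ with rfl | hl
  · simp
  obtain ⟨u, hu, hul, hlim⟩ := exists_seq_strictAnti_tendsto' (lt_top_iff_ne_top.2 hl)
  have hun : {x | l < f x} = ⋃ n, {x | u n < f x} := by
    ext x
    simp only [Set.mem_ofPred_eq, Set.mem_iUnion]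
    refine ⟨fun hx => ?_, fun ⟨n, hn⟩ => (hul n).1.trans hn⟩
    exact ((tendsto_order.1 hlim).2 _ hx).exists
  have hmono : Monotone fun n => {x | u n < f x} := fun m n hmn x hx =>
    (hu.antitone hmn).trans_lt hx
  rw [hun, hmono.measure_iUnion]
  refine iSup_le fun n => ?_
  obtain ⟨l', hl', hlt⟩ := sInf_lt_iff.1 (h.trans_lt (hul n).1)
  exact (measure_mono fun x hx => hlt.trans hx).trans hl'

lemma lt_rearr_iff {f : α → ℝ≥0∞} {t : ℝ} {l : ℝ≥0∞} :
    l < rearr μ f t ↔ ENNReal.ofReal t < μ {x | l < f x} := by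
  rw [← not_le, rearr_le_iff, not_le]

lemma rearr_antitone (μ : Measure α) (f : α → ℝ≥0∞) : Antitone (rearr μ f) := fun _ _ h =>
  rearr_le_iff.2 ((rearr_le_iff.1 le_rfl).trans (ENNReal.ofReal_le_ofReal h))

lemma measurable_rearr (μ : Measure α) (f : α → ℝ≥0∞) : Measurable (rearr μ f) :=
  (rearr_antitone μ f).measurable

lemma rearr_mono {f g : α → ℝ≥0∞} (h : f ≤ᵐ[μ] g) (t : ℝ) : rearr μ f t ≤ rearr μ g t := by
  rw [rearr_le_iff]
  refine (measure_mono_ae (t := {x | rearr μ g t < g x}) ?_).trans (rearr_le_iff.1 le_rfl)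
  filter_upwards [h] with x hx h' using lt_of_lt_of_le h' hx

lemma rearr_congr_distrib {f : α → ℝ≥0∞} {g : β → ℝ≥0∞}
    (h : ∀ l, μ {x | l < f x} = ν {x | l < g x}) : rearr μ f = rearr ν g := by
  ext t; simp only [rearr, h]

lemma rearr_comp {m : Measure β} {σ : α → β} (hσ : MeasurePreserving σ μ m) {h : β → ℝ≥0∞}
    (hh : AEMeasurable h m) : rearr μ (fun x => h (σ x)) = rearr m h :=
  rearr_congr_distrib fun _ => hσ.measure_preimage (nullMeasurableSet_lt aemeasurable_const hh)

lemma rearr_eq_zero {f : α → ℝ≥0∞} {t : ℝ} (h : μ Set.univ ≤ ENNReal.ofReal t) :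
    rearr μ f t = 0 :=
  nonpos_iff_eq_zero.1 (rearr_le_iff.2 ((measure_mono (Set.subset_univ _)).trans h))

/-- By `lt_rearr_iff` the superlevel set of the rearrangement in (0, ∞) is an interval starting at 0
whose length is the measure of the superlevel set of `f`. -/
lemma volume_lt_rearr (f : α → ℝ≥0∞) (l : ℝ≥0∞) :
    volume.restrict (Set.Ioi 0) {s | l < rearr μ f s} = μ {x | l < f x} := by
  rw [Measure.restrict_apply (measurableSet_lt measurable_const (measurable_rearr μ f)),
    ← volume_pos_ofReal_lt (μ {x | l < f x})]
  congr 1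
  ext s
  simp [lt_rearr_iff, and_comm]

lemma repMeasure_lt_rearr (f : α → ℝ≥0∞) (l : ℝ≥0∞) :
    repMeasure μ {s | l < rearr μ f s} = μ {x | l < f x} := by
  rw [repMeasure, Measure.restrict_apply (measurableSet_lt measurable_const
    (measurable_rearr μ f)), ← volume_pos_ofReal_lt (μ {x | l < f x})]
  congr 1
  ext s
  simp only [lt_rearr_iff, Set.mem_inter_iff, Set.mem_ofPred_eq]
  exact ⟨fun h => ⟨h.2.1, h.1⟩, fun h => ⟨h.2, h.1, h.2.trans_le (measure_mono (Set.subset_univ _))⟩⟩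

lemma rearr_rearr (f : α → ℝ≥0∞) : rearr (repMeasure μ) (rearr μ f) = rearr μ f :=
  rearr_congr_distrib (repMeasure_lt_rearr f)

/-- The rearrangement of a non-increasing function is at most the function. -/
lemma rearr_le_of_antitoneOn {h : ℝ → ℝ≥0∞} (hh : AntitoneOn h (Set.Ioi 0)) {s : ℝ} (hs : 0 < s) :
    rearr (repMeasure ν) h s ≤ h s := by
  rw [rearr_le_iff, repMeasure, Measure.restrict_apply' (measurableSet_repInterval _)]
  calc volume ({x | h s < h x} ∩ {t | 0 < t ∧ ENNReal.ofReal t < ν Set.univ})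
      ≤ volume (Set.Ioo 0 s) := by
        refine measure_mono fun x hx => ⟨hx.2.1, ?_⟩
        by_contra hcon
        exact absurd (hh (Set.mem_Ioi.2 hs) (Set.mem_Ioi.2 hx.2.1) (not_lt.1 hcon)) (not_le.2 hx.1)
    _ = ENNReal.ofReal s := by rw [Real.volume_Ioo, sub_zero]

/-- The rearrangement of a non-increasing function is at least the values of the function further
to the right. -/
lemma le_rearr_of_antitoneOn {h : ℝ → ℝ≥0∞} (hh : AntitoneOn h (Set.Ioi 0)) {s s' : ℝ}
    (hs : 0 < s) (hss : s < s') (hs' : ENNReal.ofReal s' < ν Set.univ) :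
    h s' ≤ rearr (repMeasure ν) h s := by
  refine le_of_forall_lt fun l hl => ?_
  rw [lt_rearr_iff, repMeasure, Measure.restrict_apply' (measurableSet_repInterval _)]
  calc ENNReal.ofReal s < ENNReal.ofReal s' := (ENNReal.ofReal_lt_ofReal_iff (hs.trans hss)).2 hss
    _ = volume (Set.Ioc 0 s') := by rw [Real.volume_Ioc, sub_zero]
    _ ≤ _ := by
      refine measure_mono fun x hx => ⟨hl.trans_le (hh hx.1 (hs.trans hss) hx.2), hx.1, ?_⟩
      exact (ENNReal.ofReal_le_ofReal hx.2).trans_lt hs'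

/-- The infimum defining `repNorm` runs over functions of equal norm, and `h ∘ σ` is one of them. -/
lemma repNorm_eq {σ : α → ℝ} (hσ : MeasurePreserving σ μ (repMeasure μ)) (X : RINorm μ)
    {h : ℝ → ℝ≥0∞} (hh : AEMeasurable h (repMeasure μ)) :
    X.repNorm h = X.norm fun x => h (σ x) := by
  have hm : AEMeasurable (fun x => h (σ x)) μ := hh.comp_quasiMeasurePreserving hσ.quasiMeasurePreserving
  have hr := rearr_comp hσ hh
  apply le_antisymm
  · exact iInf_le_of_le _ (iInf_le_of_le hm (iInf_le _ fun t _ => by rw [hr]))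
  · refine le_iInf fun f => le_iInf fun hf => le_iInf fun hfr => le_of_eq ?_
    exact X.norm_eq_of_rearr_eq _ _ hm hf fun t ht => by rw [hfr t ht, hr]

end Rearrangement

/-! ### Layer cake formula and the Hardy–Littlewood inequality. -/

section LayerCake

variable {α : Type*} [MeasurableSpace α] {μ : Measure α}

lemma lintegral_ite_ofReal_lt (c : ℝ≥0∞) :
    ∫⁻ l in Set.Ioi (0 : ℝ), (if ENNReal.ofReal l < c then 1 else 0 : ℝ≥0∞) = c := by
  have hm : MeasurableSet {l : ℝ | ENNReal.ofReal l < c} :=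
    measurableSet_lt ENNReal.measurable_ofReal measurable_const
  have : (fun l : ℝ => (if ENNReal.ofReal l < c then 1 else 0 : ℝ≥0∞)) =
      {l : ℝ | ENNReal.ofReal l < c}.indicator fun _ => 1 := by
    ext l; simp [Set.indicator_apply]
  rw [this, lintegral_indicator_const hm, one_mul, Measure.restrict_apply hm]
  conv_rhs => rw [← volume_pos_ofReal_lt c]
  congr 1
  ext l; simp [and_comm]

lemma measurable_ite_ofReal_lt {u : α → ℝ≥0∞} (hu : Measurable u) :
    Measurable fun p : α × ℝ => (if ENNReal.ofReal p.2 < u p.1 then 1 else 0 : ℝ≥0∞) :=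
  Measurable.ite (measurableSet_lt (ENNReal.measurable_ofReal.comp measurable_snd)
    (hu.comp measurable_fst)) measurable_const measurable_const

/-- The layer cake formula for a product. -/
lemma lintegral_mul_eq_lintegral_measure [SFinite μ] {u v : α → ℝ≥0∞} (hu : Measurable u)
    (hv : Measurable v) :
    ∫⁻ x, u x * v x ∂μ = ∫⁻ k in Set.Ioi (0 : ℝ), ∫⁻ l in Set.Ioi (0 : ℝ),
      μ ({x | ENNReal.ofReal k < u x} ∩ {x | ENNReal.ofReal l < v x}) := by
  have ha := measurable_ite_ofReal_lt hu
  have hb := measurable_ite_ofReal_lt hv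
  have hak : ∀ k : ℝ, Measurable fun x => (if ENNReal.ofReal k < u x then 1 else 0 : ℝ≥0∞) :=
    fun k => ha.comp (measurable_id.prodMk measurable_const)
  have hbx : ∀ x, Measurable fun l : ℝ => (if ENNReal.ofReal l < v x then 1 else 0 : ℝ≥0∞) :=
    fun x => hb.comp (measurable_const.prodMk measurable_id)
  have hax : ∀ x, Measurable fun l : ℝ => (if ENNReal.ofReal l < u x then 1 else 0 : ℝ≥0∞) :=
    fun x => ha.comp (measurable_const.prodMk measurable_id)
  calc ∫⁻ x, u x * v x ∂μ
      = ∫⁻ x, (∫⁻ k in Set.Ioi (0 : ℝ), (if ENNReal.ofReal k < u x then 1 else 0) * v x) ∂μ := by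
        refine lintegral_congr fun x => ?_
        rw [lintegral_mul_const _ (hax x), lintegral_ite_ofReal_lt]
    _ = ∫⁻ k in Set.Ioi (0 : ℝ), ∫⁻ x, (if ENNReal.ofReal k < u x then 1 else 0) * v x ∂μ :=
        lintegral_lintegral_swap (ha.mul (hv.comp measurable_fst)).aemeasurable
    _ = ∫⁻ k in Set.Ioi (0 : ℝ), ∫⁻ x, (∫⁻ l in Set.Ioi (0 : ℝ),
          (if ENNReal.ofReal k < u x then 1 else 0) *
            (if ENNReal.ofReal l < v x then 1 else 0)) ∂μ := by
        refine lintegral_congr fun k => lintegral_congr fun x => ?_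
        rw [lintegral_const_mul _ (hbx x), lintegral_ite_ofReal_lt]
    _ = ∫⁻ k in Set.Ioi (0 : ℝ), ∫⁻ l in Set.Ioi (0 : ℝ), ∫⁻ x,
          (if ENNReal.ofReal k < u x then 1 else 0) *
            (if ENNReal.ofReal l < v x then 1 else 0) ∂μ := by
        refine lintegral_congr fun k => ?_
        exact lintegral_lintegral_swap (((hak k).comp measurable_fst).mul hb).aemeasurable
    _ = _ := by
        refine lintegral_congr fun k => lintegral_congr fun l => ?_
        rw [← lintegral_indicator_one ((measurableSet_lt measurable_const hu).inter
          (measurableSet_lt measurable_const hv))]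
        refine lintegral_congr fun x => ?_
        by_cases h1 : ENNReal.ofReal k < u x <;> by_cases h2 : ENNReal.ofReal l < v x <;>
          simp [h1, h2]

/-- The Hardy–Littlewood inequality against a non-increasing function of a measure preserving
map. -/
theorem lintegral_comp_mul_le [SFinite μ] {σ : α → ℝ} (hσ : MeasurePreserving σ μ (repMeasure μ))
    {φ : ℝ → ℝ≥0∞} (hφ : Measurable φ) (hanti : AntitoneOn φ (Set.Ioi 0)) {g : α → ℝ≥0∞}
    (hg : Measurable g) :
    ∫⁻ x, φ (σ x) * g x ∂μ ≤ ∫⁻ s in Set.Ioi 0, φ s * rearr μ g s := by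
  rw [lintegral_mul_eq_lintegral_measure (u := fun x => φ (σ x)) (hφ.comp hσ.measurable) hg,
    lintegral_mul_eq_lintegral_measure hφ (measurable_rearr μ g)]
  refine lintegral_mono fun k => lintegral_mono fun l => ?_
  have hP : MeasurableSet {s | ENNReal.ofReal k < φ s} := measurableSet_lt measurable_const hφ
  -- Superlevel sets of two non-increasing functions are nested on (0, ∞). Their intersection is
  -- therefore the smaller of the two, which bounds the intersection on the left.
  have hcase : {s | ENNReal.ofReal k < φ s} ∩ Set.Ioi 0 ⊆ {s | ENNReal.ofReal l < rearr μ g s} ∨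
      {s | ENNReal.ofReal l < rearr μ g s} ∩ Set.Ioi 0 ⊆ {s | ENNReal.ofReal k < φ s} := by
    by_contra! hcon
    obtain ⟨h1, h2⟩ := hcon
    obtain ⟨s, ⟨hs, hs0⟩, hs'⟩ := Set.not_subset.1 h1
    obtain ⟨t, ⟨ht, ht0⟩, ht'⟩ := Set.not_subset.1 h2
    rcases le_total s t with h | h
    · exact hs' (lt_of_lt_of_le ht (rearr_antitone μ g h))
    · exact ht' (lt_of_lt_of_le hs (hanti ht0 hs0 h))
  rcases hcase with h | h
  · calc _ ≤ μ {x | ENNReal.ofReal k < φ (σ x)} := measure_mono Set.inter_subset_left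
      _ = repMeasure μ {s | ENNReal.ofReal k < φ s} := hσ.measure_preimage hP.nullMeasurableSet
      _ ≤ volume.restrict (Set.Ioi 0) {s | ENNReal.ofReal k < φ s} :=
        Measure.restrict_mono (fun s hs => hs.1) le_rfl _
      _ ≤ _ := by
        rw [Measure.restrict_apply' measurableSet_Ioi, Measure.restrict_apply' measurableSet_Ioi]
        exact measure_mono fun s hs => ⟨⟨hs.1, h hs⟩, hs.2⟩
  · calc _ ≤ μ {x | ENNReal.ofReal l < g x} := measure_mono Set.inter_subset_right
      _ = volume.restrict (Set.Ioi 0) {s | ENNReal.ofReal l < rearr μ g s} :=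
        (volume_lt_rearr g _).symm
      _ ≤ _ := by
        rw [Measure.restrict_apply' measurableSet_Ioi, Measure.restrict_apply' measurableSet_Ioi]
        exact measure_mono fun s hs => ⟨⟨h hs, hs.1⟩, hs.2⟩

end LayerCake

/-! ### Power substitutions and the integrable kernel. -/

section PowerIntegrals

/-- The substitution u = v t^r. It serves as a dilation (r = 1), as a power (v = 1), and with both
parameters in the Hardy type inequality. -/
lemma lintegral_comp_mul_rpow {v r : ℝ} (hv : 0 < v) (hr : 0 < r) (F : ℝ → ℝ≥0∞) :
    ∫⁻ t in Set.Ioi (0 : ℝ), ENNReal.ofReal (v * (r * t ^ (r - 1))) * F (v * t ^ r) =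
      ∫⁻ u in Set.Ioi (0 : ℝ), F u := by
  have himg : (fun t : ℝ => v * t ^ r) '' Set.Ioi 0 = Set.Ioi 0 := by
    ext u
    constructor
    · rintro ⟨t, ht, rfl⟩
      exact mul_pos hv (Real.rpow_pos_of_pos ht r)
    · intro hu
      have hu' : 0 < u / v := div_pos hu hv
      refine ⟨(u / v) ^ (1 / r), Real.rpow_pos_of_pos hu' _, ?_⟩
      dsimp only
      rw [← Real.rpow_mul hu'.le, one_div_mul_cancel hr.ne', Real.rpow_one, mul_div_cancel₀ _ hv.ne']
  have hinj : Set.InjOn (fun t : ℝ => v * t ^ r) (Set.Ioi 0) := by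
    intro s hs t ht h
    exact (Real.rpow_left_inj hs.le ht.le hr.ne').1 (mul_left_cancel₀ hv.ne' h)
  have hder : ∀ t ∈ Set.Ioi (0 : ℝ), HasDerivWithinAt (fun t : ℝ => v * t ^ r)
      (v * (r * t ^ (r - 1))) (Set.Ioi 0) t := fun t ht =>
    ((Real.hasDerivAt_rpow_const (Or.inl (ne_of_gt ht))).const_mul v).hasDerivWithinAt
  have := lintegral_image_eq_lintegral_abs_deriv_mul measurableSet_Ioi hder hinj F
  rw [himg] at this
  rw [this]
  refine setLIntegral_congr_fun measurableSet_Ioi fun t ht => ?_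
  have h0 : 0 ≤ v * (r * t ^ (r - 1)) :=
    mul_nonneg hv.le (mul_nonneg hr.le (Real.rpow_nonneg (le_of_lt ht) _))
  simp only [abs_of_nonneg h0]

lemma setLIntegral_Ioc_rpow {a e : ℝ} (ha : 0 < a) (he : 0 < e) :
    ∫⁻ s in Set.Ioc 0 a, ENNReal.ofReal (s ^ (e - 1)) = ENNReal.ofReal (a ^ e / e) := by
  have hint : IntegrableOn (fun s : ℝ => s ^ (e - 1)) (Set.Ioc 0 a) :=
    (intervalIntegral.intervalIntegrable_rpow' (by linarith)).1
  rw [← ofReal_integral_eq_lintegral_ofReal hint]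
  · rw [← intervalIntegral.integral_of_le ha.le, integral_rpow (Or.inl (by linarith)),
      sub_add_cancel, Real.zero_rpow he.ne', sub_zero]
  · exact (ae_restrict_iff' measurableSet_Ioc).2
      (Eventually.of_forall fun s hs => Real.rpow_nonneg hs.1.le _)

/-- The mass of the kernel `v^(-1/p) (1 + v)^(1/q - 1)`. -/
lemma lintegral_kernel_lt_top {p q : ℝ} (hp : 1 < p) (hpq : p < q) :
    ∫⁻ v in Set.Ioi (0 : ℝ), ENNReal.ofReal (v ^ (-(1 / p)) * (1 + v) ^ (1 / q - 1)) < ∞ := by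
  have hp0 : 0 < p := by linarith
  have hq0 : 0 < q := by linarith
  have h1p : 1 / p < 1 := by rw [div_lt_one hp0]; exact hp
  have hqp : 1 / q < 1 / p := one_div_lt_one_div_of_lt hp0 hpq
  rw [← Set.Ioc_union_Ioi_eq_Ioi (zero_le_one' ℝ)]
  refine (lintegral_union_le _ _ _).trans_lt (ENNReal.add_lt_top.2 ⟨?_, ?_⟩)
  -- Near 0 the kernel is at most v^{-1/p}, integrable since p > 1; near infinity it is at most
  -- v^{1/q-1/p-1}, integrable since p < q.
  · have hint : IntegrableOn (fun s : ℝ => s ^ (-(1 / p))) (Set.Ioc 0 1) :=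
      (intervalIntegral.intervalIntegrable_rpow' (by linarith)).1
    refine lt_of_le_of_lt (setLIntegral_mono' measurableSet_Ioc fun v hv => ?_)
      hint.lintegral_lt_top
    refine ENNReal.ofReal_le_ofReal ?_
    have : (1 + v) ^ (1 / q - 1) ≤ 1 :=
      Real.rpow_le_one_of_one_le_of_nonpos (by linarith [hv.1]) (by linarith)
    exact mul_le_of_le_one_right (Real.rpow_nonneg hv.1.le _) this
  · have hint : IntegrableOn (fun s : ℝ => s ^ (-(1 / p) + (1 / q - 1))) (Set.Ioi 1) :=
      integrableOn_Ioi_rpow_of_lt (by linarith) one_pos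
    refine lt_of_le_of_lt (setLIntegral_mono' measurableSet_Ioi fun v hv => ?_)
      hint.lintegral_lt_top
    have hv0 : (0 : ℝ) < v := lt_trans one_pos hv
    refine ENNReal.ofReal_le_ofReal ?_
    rw [Real.rpow_add hv0]
    refine mul_le_mul_of_nonneg_left ?_ (Real.rpow_nonneg hv0.le _)
    exact Real.rpow_le_rpow_of_nonpos hv0 (by linarith) (by linarith)

/-- Jensen's inequality for a weight. -/
lemma lintegral_mul_rpow_le {α : Type*} [MeasurableSpace α] {μ : Measure α} {b : ℝ} (hb : 1 ≤ b)
    {w G : α → ℝ≥0∞} (hw : Measurable w) (hG : Measurable G) :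
    (∫⁻ x, w x * G x ∂μ) ^ b ≤ (∫⁻ x, w x ∂μ) ^ (b - 1) * ∫⁻ x, w x * G x ^ b ∂μ := by
  have hb0 : 0 < b := by linarith
  have h := eLpNorm'_le_eLpNorm'_mul_rpow_measure_univ (μ := μ.withDensity w) (p := 1) (q := b)
    one_pos hb hG.aestronglyMeasurable
  simp only [eLpNorm', enorm_eq_self, ENNReal.rpow_one, div_one] at h
  rw [lintegral_withDensity_eq_lintegral_mul _ hw hG,
    lintegral_withDensity_eq_lintegral_mul _ hw (hG.pow_const b),
    withDensity_apply _ MeasurableSet.univ, Measure.restrict_univ] at h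
  refine (ENNReal.rpow_le_rpow h hb0.le).trans_eq ?_
  rw [ENNReal.mul_rpow_of_nonneg _ _ hb0.le, ← ENNReal.rpow_mul, ← ENNReal.rpow_mul,
    one_div_mul_cancel hb0.ne', ENNReal.rpow_one, mul_comm, sub_mul, one_mul,
    one_div_mul_cancel hb0.ne']
  rfl

end PowerIntegrals

/-! ### The Lorentz functional on intervals. -/

section Lorentz

variable {p : ℝ} {q₀ : ℝ≥0∞}

lemma one_le_toReal (h1 : 1 ≤ q₀) (h : q₀ ≠ ∞) : 1 ≤ q₀.toReal := by
  simpa using ENNReal.toReal_mono h h1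

lemma lorentzFunctional_top (I : Set ℝ) (g : ℝ → ℝ≥0∞) :
    lorentzFunctional p ∞ I g = ⨆ s ∈ I, ENNReal.ofReal (s ^ (1 / p)) * g s := if_pos rfl

lemma lorentzFunctional_of_ne_top (h : q₀ ≠ ∞) (I : Set ℝ) (g : ℝ → ℝ≥0∞) :
    lorentzFunctional p q₀ I g = (∫⁻ s in I, ENNReal.ofReal (s ^ (q₀.toReal / p - 1)) *
      g s ^ q₀.toReal) ^ (1 / q₀.toReal) := if_neg h

/-- The comparison is required only where `g` is nonzero, so `I` may exceed `J` when `g` vanishes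
outside `J`; this is how small supports are exploited. -/
lemma lorentzFunctional_mono (h1 : 1 ≤ q₀) {I J : Set ℝ} (hI : MeasurableSet I)
    (hJ : MeasurableSet J) {g h : ℝ → ℝ≥0∞} (hgh : ∀ s ∈ I, g s ≠ 0 → s ∈ J ∧ g s ≤ h s) :
    lorentzFunctional p q₀ I g ≤ lorentzFunctional p q₀ J h := by
  rcases eq_or_ne q₀ ∞ with rfl | hq
  · simp only [lorentzFunctional_top]
    refine iSup₂_le fun s hs => ?_
    by_cases h0 : g s = 0
    · simp [h0]
    · obtain ⟨hsJ, hle⟩ := hgh s hs h0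
      exact le_iSup₂_of_le s hsJ (by gcongr)
  · have hb := one_le_toReal h1 hq
    have hb0 : 0 < q₀.toReal := by linarith
    simp only [lorentzFunctional_of_ne_top hq]
    refine ENNReal.rpow_le_rpow ?_ (by positivity)
    rw [← lintegral_indicator hI, ← lintegral_indicator hJ]
    refine lintegral_mono fun s => ?_
    by_cases hs : s ∈ I
    · rw [Set.indicator_of_mem hs]
      by_cases h0 : g s = 0
      · simp [h0, ENNReal.zero_rpow_of_pos hb0]
      · obtain ⟨hsJ, hle⟩ := hgh s hs h0
        rw [Set.indicator_of_mem hsJ]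
        gcongr
    · simp [Set.indicator_of_notMem hs]

lemma lorentzFunctional_const_mul (h1 : 1 ≤ q₀) (I : Set ℝ) (g : ℝ → ℝ≥0∞) {c : ℝ≥0∞}
    (hc : c ≠ ∞) :
    lorentzFunctional p q₀ I (fun s => c * g s) = c * lorentzFunctional p q₀ I g := by
  rcases eq_or_ne q₀ ∞ with rfl | hq
  · simp only [lorentzFunctional_top, ENNReal.mul_iSup]
    refine iSup_congr fun s => iSup_congr fun _ => ?_
    ring
  · have hb := one_le_toReal h1 hq
    have hb0 : 0 < q₀.toReal := by linarith
    simp only [lorentzFunctional_of_ne_top hq]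
    have : ∀ s : ℝ, ENNReal.ofReal (s ^ (q₀.toReal / p - 1)) * (c * g s) ^ q₀.toReal =
        c ^ q₀.toReal * (ENNReal.ofReal (s ^ (q₀.toReal / p - 1)) * g s ^ q₀.toReal) := fun s => by
      rw [ENNReal.mul_rpow_of_nonneg _ _ hb0.le]; ring
    simp only [this]
    rw [lintegral_const_mul' _ _ (ENNReal.rpow_ne_top_of_nonneg hb0.le hc),
      ENNReal.mul_rpow_of_nonneg _ _ (by positivity), ← ENNReal.rpow_mul,
      mul_one_div_cancel hb0.ne', ENNReal.rpow_one]

/-- A constant is harmless here, so convexity of x^b and subadditivity of the b-th root replace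
Minkowski's inequality; the factor is 2^{1-1/b} ≤ 2. -/
lemma lorentzFunctional_add_le (h1 : 1 ≤ q₀) (I : Set ℝ) {g : ℝ → ℝ≥0∞} (hg : Measurable g)
    (h : ℝ → ℝ≥0∞) :
    lorentzFunctional p q₀ I (fun s => g s + h s) ≤
      2 * (lorentzFunctional p q₀ I g + lorentzFunctional p q₀ I h) := by
  rcases eq_or_ne q₀ ∞ with rfl | hq
  · refine le_trans ?_ (le_mul_of_one_le_left' one_le_two)
    simp only [lorentzFunctional_top]
    refine iSup₂_le fun s hs => ?_
    rw [mul_add]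
    exact add_le_add (le_iSup₂_of_le s hs le_rfl) (le_iSup₂_of_le s hs le_rfl)
  · have hb := one_le_toReal h1 hq
    have hb0 : 0 < q₀.toReal := by linarith
    simp only [lorentzFunctional_of_ne_top hq]
    set b := q₀.toReal
    have hptw : ∀ s : ℝ, ENNReal.ofReal (s ^ (b / p - 1)) * (g s + h s) ^ b ≤
        2 ^ (b - 1) * (ENNReal.ofReal (s ^ (b / p - 1)) * g s ^ b +
          ENNReal.ofReal (s ^ (b / p - 1)) * h s ^ b) := fun s => by
      calc _ ≤ ENNReal.ofReal (s ^ (b / p - 1)) * (2 ^ (b - 1) * (g s ^ b + h s ^ b)) := by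
            gcongr; exact ENNReal.rpow_add_le_mul_rpow_add_rpow _ _ hb
        _ = _ := by ring
    have hmeas : Measurable fun s : ℝ => ENNReal.ofReal (s ^ (b / p - 1)) * g s ^ b := by fun_prop
    have h2 : (2 : ℝ≥0∞) ^ (b - 1) ≠ ∞ :=
      ENNReal.rpow_ne_top_of_nonneg (by linarith) ENNReal.ofNat_ne_top
    calc _ ≤ ((2 : ℝ≥0∞) ^ (b - 1) * ((∫⁻ s in I, ENNReal.ofReal (s ^ (b / p - 1)) * g s ^ b) +
          ∫⁻ s in I, ENNReal.ofReal (s ^ (b / p - 1)) * h s ^ b)) ^ (1 / b) := by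
          refine ENNReal.rpow_le_rpow ?_ (by positivity)
          rw [← lintegral_add_left hmeas, ← lintegral_const_mul' _ _ h2]
          exact lintegral_mono hptw
      _ = (2 : ℝ≥0∞) ^ ((b - 1) * (1 / b)) * ((∫⁻ s in I, ENNReal.ofReal (s ^ (b / p - 1)) *
          g s ^ b) + ∫⁻ s in I, ENNReal.ofReal (s ^ (b / p - 1)) * h s ^ b) ^ (1 / b) := by
          rw [ENNReal.mul_rpow_of_nonneg _ _ (by positivity), ← ENNReal.rpow_mul]
      _ ≤ _ := by
          refine mul_le_mul' ?_ (ENNReal.rpow_add_le_add_rpow _ _ (by positivity) ?_)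
          · calc (2 : ℝ≥0∞) ^ ((b - 1) * (1 / b)) ≤ 2 ^ (1 : ℝ) := by
                  refine ENNReal.rpow_le_rpow_of_exponent_le one_le_two ?_
                  rw [mul_one_div, div_le_one hb0]; linarith
              _ = 2 := ENNReal.rpow_one _
          · rw [div_le_one hb0]; exact hb

/-- Since κ is nonzero, this recovers pointwise bounds: for non-increasing `g` the functional over
(0, t] is at least κ t^{1/p} g(t). -/
lemma lorentzFunctional_const (hp : 0 < p) (h1 : 1 ≤ q₀) :
    ∃ κ : ℝ≥0, κ ≠ 0 ∧ ∀ t : ℝ, 0 < t → ∀ c : ℝ≥0∞,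
      lorentzFunctional p q₀ (Set.Ioc 0 t) (fun _ => c) = κ * (ENNReal.ofReal (t ^ (1 / p)) * c) := by
  rcases eq_or_ne q₀ ∞ with rfl | hq
  · refine ⟨1, one_ne_zero, fun t ht c => ?_⟩
    rw [lorentzFunctional_top, ENNReal.coe_one, one_mul]
    apply le_antisymm
    · refine iSup₂_le fun s hs => ?_
      gcongr
      exacts [hs.1.le, hs.2]
    · exact le_iSup₂_of_le t ⟨ht, le_rfl⟩ le_rfl
  · have hb := one_le_toReal h1 hq
    have hb0 : 0 < q₀.toReal := by linarith
    simp only [lorentzFunctional_of_ne_top hq]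
    set b := q₀.toReal
    have hpb : 0 < p / b := by positivity
    refine ⟨Real.toNNReal ((p / b) ^ (1 / b)), ?_, fun t ht c => ?_⟩
    · exact (Real.toNNReal_pos.2 (Real.rpow_pos_of_pos hpb _)).ne'
    · rw [lintegral_mul_const _ (by fun_prop), setLIntegral_Ioc_rpow ht (by positivity),
        ENNReal.mul_rpow_of_nonneg _ _ (by positivity), ← ENNReal.rpow_mul,
        mul_one_div_cancel hb0.ne', ENNReal.rpow_one,
        ENNReal.ofReal_rpow_of_nonneg (by positivity) (by positivity), ← mul_assoc]
      congr 1
      change _ = ENNReal.ofReal _ * _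
      rw [← ENNReal.ofReal_mul (by positivity)]
      congr 1
      rw [div_eq_mul_inv, Real.mul_rpow (by positivity) (by positivity), inv_div,
        ← Real.rpow_mul ht.le, mul_comm]
      congr 2
      field_simp

/-- The substitution `s = u ^ r` in the Lorentz functional. -/
lemma lorentzFunctional_comp_rpow {p₀ p₁ q r : ℝ} (hr : 0 < r) (hrel : r / p₀ = 1 / p₁ + r / q)
    (h1 : 1 ≤ q₀) :
    ∃ κ : ℝ≥0, ∀ t : ℝ, 0 < t → ∀ g : ℝ → ℝ≥0∞,
      lorentzFunctional p₀ q₀ (Set.Ioc 0 (t ^ r)) g ≤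
        κ * lorentzFunctional p₁ q₀ (Set.Ioc 0 t)
          (fun u => ENNReal.ofReal (u ^ (r / q)) * g (u ^ r)) := by
  rcases eq_or_ne q₀ ∞ with rfl | hq
  · refine ⟨1, fun t ht g => ?_⟩
    simp only [lorentzFunctional_top, ENNReal.coe_one, one_mul]
    refine iSup₂_le fun s hs => ?_
    have hu : 0 < s ^ (1 / r) := Real.rpow_pos_of_pos hs.1 _
    have hur : (s ^ (1 / r)) ^ r = s := by
      rw [← Real.rpow_mul hs.1.le, one_div_mul_cancel hr.ne', Real.rpow_one]
    refine le_iSup₂_of_le (s ^ (1 / r)) ⟨hu, ?_⟩ ?_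
    · refine (Real.rpow_le_rpow_iff hu.le ht.le hr).1 ?_
      rw [hur]; exact hs.2
    · rw [hur, ← mul_assoc, ← ENNReal.ofReal_mul (Real.rpow_nonneg hu.le _), ← Real.rpow_add hu,
        ← hrel, ← Real.rpow_mul hs.1.le]
      refine le_of_eq ?_
      congr 3
      field_simp
  · have hb := one_le_toReal h1 hq
    have hb0 : 0 < q₀.toReal := by linarith
    simp only [lorentzFunctional_of_ne_top hq]
    set b := q₀.toReal
    -- For finite q₀ this is an equality; r is the constant factor of the derivative of u^r.
    refine ⟨Real.toNNReal (r ^ (1 / b)), fun t ht g => le_of_eq ?_⟩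
    change _ = ENNReal.ofReal _ * _
    rw [← ENNReal.ofReal_rpow_of_nonneg hr.le (by positivity),
      ← ENNReal.mul_rpow_of_nonneg _ _ (by positivity),
      ← lintegral_const_mul' _ _ ENNReal.ofReal_ne_top,
      ← Set.Ioi_inter_Iic, ← Set.Ioi_inter_Iic]
    congr 1
    rw [Set.inter_comm, ← setLIntegral_indicator measurableSet_Iic, Set.inter_comm,
      ← setLIntegral_indicator measurableSet_Iic, ← lintegral_comp_mul_rpow one_pos hr]
    refine setLIntegral_congr_fun measurableSet_Ioi fun u hu => ?_
    have hu0 : (0 : ℝ) < u := hu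
    simp only [one_mul]
    by_cases hut : u ≤ t
    · rw [Set.indicator_of_mem (Set.mem_Iic.2 (Real.rpow_le_rpow hu0.le hut hr.le)),
        Set.indicator_of_mem (Set.mem_Iic.2 hut), ENNReal.mul_rpow_of_nonneg _ _ hb0.le,
        ENNReal.ofReal_rpow_of_nonneg (Real.rpow_nonneg hu0.le _) hb0.le, ← mul_assoc, ← mul_assoc,
        ← mul_assoc, ← ENNReal.ofReal_mul (by positivity), ← ENNReal.ofReal_mul (by positivity),
        ← ENNReal.ofReal_mul (by positivity)]
      congr 2
      rw [mul_assoc, mul_assoc, ← Real.rpow_mul hu0.le, ← Real.rpow_mul hu0.le,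
        ← Real.rpow_add hu0, ← Real.rpow_add hu0]
      congr 2
      linear_combination b * hrel
    · rw [Set.indicator_of_notMem, Set.indicator_of_notMem, mul_zero]
      · simpa using hut
      · simpa [Real.rpow_le_rpow_iff hu0.le ht.le hr] using hut

end Lorentz

/-! ### The Stieltjes type integral and its Hardy type inequality. -/

/-- The integral `∫_0^∞ (s + a)^(1/q - 1) g(s) ds`. -/
noncomputable def stieltjes (q : ℝ) (g : ℝ → ℝ≥0∞) (a : ℝ) : ℝ≥0∞ :=
  ∫⁻ s in Set.Ioi (0 : ℝ), ENNReal.ofReal ((s + a) ^ (1 / q - 1)) * g s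

section Stieltjes

variable {q : ℝ}

lemma stieltjes_antitoneOn (hq : 1 < q) (g : ℝ → ℝ≥0∞) :
    AntitoneOn (stieltjes q g) (Set.Ici 0) := by
  intro a ha b _ hab
  have h1 : 1 / q - 1 ≤ 0 := by
    have : 1 / q < 1 := by rw [div_lt_one (by linarith)]; exact hq
    linarith
  refine setLIntegral_mono' measurableSet_Ioi fun s hs => ?_
  gcongr ENNReal.ofReal ?_ * _
  have hs0 : (0 : ℝ) < s := hs
  have ha0 : (0 : ℝ) ≤ a := ha
  exact Real.rpow_le_rpow_of_nonpos (by linarith) (by linarith) h1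

/-- From s + c a ≤ c (s + a): a dilation of the argument costs only a power of c. -/
lemma stieltjes_mul (hq : 1 < q) (g : ℝ → ℝ≥0∞) {a c : ℝ} (ha : 0 < a) (hc : 1 ≤ c) :
    stieltjes q g a ≤ ENNReal.ofReal (c ^ (1 - 1 / q)) * stieltjes q g (c * a) := by
  have h1 : 1 / q - 1 ≤ 0 := by
    have : 1 / q < 1 := by rw [div_lt_one (by linarith)]; exact hq
    linarith
  have hc0 : 0 < c := by linarith
  rw [stieltjes, stieltjes, ← lintegral_const_mul' _ _ ENNReal.ofReal_ne_top]
  refine setLIntegral_mono' measurableSet_Ioi fun s hs => ?_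
  have hs0 : (0 : ℝ) < s := hs
  rw [← mul_assoc, ← ENNReal.ofReal_mul (by positivity)]
  gcongr ENNReal.ofReal ?_ * _
  have hle : s + c * a ≤ c * (s + a) := by nlinarith
  calc (s + a) ^ (1 / q - 1) = c ^ (1 - 1 / q) * (c * (s + a)) ^ (1 / q - 1) := by
        rw [Real.mul_rpow hc0.le (by positivity), ← mul_assoc, ← Real.rpow_add hc0]
        simp
    _ ≤ _ := by
        refine mul_le_mul_of_nonneg_left ?_ (by positivity)
        exact Real.rpow_le_rpow_of_nonpos (by positivity) hle h1

/-- After s = a v, the factor 1 = v^{-1/p} v^{1/p} is split so that the kernel becomes a weight of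
finite mass, ready for Jensen's inequality, while v^{1/p} g(a v) carries the Lorentz norm. -/
lemma stieltjes_eq_scale (p : ℝ) (g : ℝ → ℝ≥0∞) {a : ℝ} (ha : 0 < a) :
    stieltjes q g a = ENNReal.ofReal (a ^ (1 / q)) * ∫⁻ v in Set.Ioi (0 : ℝ),
      ENNReal.ofReal (v ^ (-(1 / p)) * (1 + v) ^ (1 / q - 1)) *
        (ENNReal.ofReal (v ^ (1 / p)) * g (a * v)) := by
  rw [stieltjes, ← lintegral_comp_mul_rpow ha one_pos,
    ← lintegral_const_mul' _ _ ENNReal.ofReal_ne_top]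
  refine setLIntegral_congr_fun measurableSet_Ioi fun v hv => ?_
  have hv0 : (0 : ℝ) < v := hv
  simp only [Real.rpow_one, sub_self, Real.rpow_zero, mul_one]
  rw [← mul_assoc, ← mul_assoc, ← mul_assoc, ← ENNReal.ofReal_mul ha.le,
    ← ENNReal.ofReal_mul (by positivity), ← ENNReal.ofReal_mul (by positivity)]
  congr 2
  have h2 : v ^ (-(1 / p)) * v ^ (1 / p) = 1 := by rw [← Real.rpow_add hv0]; simp
  have h3 : a * v + a = a * (1 + v) := by ring
  have h4 : a * a ^ (1 / q - 1) = a ^ (1 / q) := by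
    rw [Real.rpow_sub_one ha.ne']; field_simp
  rw [h3, Real.mul_rpow ha.le (by positivity), ← h4]
  linear_combination (-(a * a ^ (1 / q - 1) * (1 + v) ^ (1 / q - 1))) * h2

/-- The Hardy type inequality behind the first endpoint estimate. -/
theorem lorentzFunctional_stieltjes_le {p₀ p₁ r : ℝ} {q₀ : ℝ≥0∞} (hp₀ : 1 < p₀) (hq : p₀ < q)
    (hr : 0 < r) (hrel : r / p₀ = 1 / p₁ + r / q) (h1 : 1 ≤ q₀) :
    ∃ C : ℝ≥0, ∀ g : ℝ → ℝ≥0∞, Measurable g →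
      lorentzFunctional p₁ q₀ (Set.Ioi 0) (fun t => stieltjes q g (t ^ r)) ≤
        C * lorentzFunctional p₀ q₀ (Set.Ioi 0) g := by
  set w : ℝ → ℝ≥0∞ := fun v => ENNReal.ofReal (v ^ (-(1 / p₀)) * (1 + v) ^ (1 / q - 1)) with hw
  have hwm : Measurable w := by fun_prop
  have hK : ∫⁻ v in Set.Ioi (0 : ℝ), w v < ∞ := lintegral_kernel_lt_top hp₀ hq
  set K := ∫⁻ v in Set.Ioi (0 : ℝ), w v with hKdef
  rcases eq_or_ne q₀ ∞ with rfl | hq₀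
  · refine ⟨K.toNNReal, fun g hg => ?_⟩
    rw [ENNReal.coe_toNNReal hK.ne]
    simp only [lorentzFunctional_top]
    refine iSup₂_le fun t ht => ?_
    have ht0 : (0 : ℝ) < t := ht
    have htr : 0 < t ^ r := Real.rpow_pos_of_pos ht0 r
    set N := ⨆ s ∈ Set.Ioi (0 : ℝ), ENNReal.ofReal (s ^ (1 / p₀)) * g s with hN
    rw [stieltjes_eq_scale p₀ g htr, ← mul_assoc, ← ENNReal.ofReal_mul (by positivity),
      ← lintegral_const_mul' _ _ ENNReal.ofReal_ne_top, hKdef, ← lintegral_mul_const _ hwm]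
    refine setLIntegral_mono' measurableSet_Ioi fun v hv => ?_
    have hv0 : (0 : ℝ) < v := hv
    have hle : ENNReal.ofReal ((t ^ r * v) ^ (1 / p₀)) * g (t ^ r * v) ≤ N :=
      le_iSup₂_of_le (t ^ r * v) (mul_pos htr hv0) le_rfl
    have hexp : t ^ (1 / p₁) * (t ^ r) ^ (1 / q) * v ^ (1 / p₀) = (t ^ r * v) ^ (1 / p₀) := by
      rw [Real.mul_rpow htr.le hv0.le, ← Real.rpow_mul ht0.le, ← Real.rpow_mul ht0.le,
        ← Real.rpow_add ht0]
      congr 2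
      linear_combination -hrel
    calc _ = w v * (ENNReal.ofReal ((t ^ r * v) ^ (1 / p₀)) * g (t ^ r * v)) := by
          rw [← hexp, ENNReal.ofReal_mul (p := t ^ (1 / p₁) * (t ^ r) ^ (1 / q)) (by positivity)]
          simp only [hw]
          ring
      _ ≤ _ := by gcongr
  · have hb := one_le_toReal h1 hq₀
    have hb0 : 0 < q₀.toReal := by linarith
    simp only [lorentzFunctional_of_ne_top hq₀]
    set b := q₀.toReal
    have hCfin : (ENNReal.ofReal (1 / r) * K ^ b) ^ (1 / b) ≠ ∞ :=
      ENNReal.rpow_ne_top_of_nonneg (by positivity) (ENNReal.mul_ne_top ENNReal.ofReal_ne_top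
        (ENNReal.rpow_ne_top_of_nonneg hb0.le hK.ne))
    refine ⟨((ENNReal.ofReal (1 / r) * K ^ b) ^ (1 / b)).toNNReal, fun g hg => ?_⟩
    rw [ENNReal.coe_toNNReal hCfin, ← ENNReal.mul_rpow_of_nonneg _ _ (by positivity)]
    refine ENNReal.rpow_le_rpow ?_ (by positivity)
    set N := ∫⁻ s in Set.Ioi (0 : ℝ), ENNReal.ofReal (s ^ (b / p₀ - 1)) * g s ^ b with hN
    have hG : ∀ a : ℝ, Measurable fun v : ℝ => ENNReal.ofReal (v ^ (1 / p₀)) * g (a * v) := by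
      intro a; fun_prop
    have hKb : K ^ (b - 1) ≠ ∞ := ENNReal.rpow_ne_top_of_nonneg (by linarith) hK.ne
    -- The substitution s = v t^r removes all dependence on v, thanks to the factor v^{1/p₀}.
    -- Jensen's inequality and Tonelli's theorem then leave only the mass of the kernel.
    have hinner : ∀ v : ℝ, 0 < v → ∫⁻ t in Set.Ioi (0 : ℝ),
        ENNReal.ofReal (t ^ (r * b / p₀ - 1)) * (ENNReal.ofReal (v ^ (1 / p₀)) * g (t ^ r * v)) ^ b
          = ENNReal.ofReal (1 / r) * N := by
      intro v hv
      rw [hN, ← lintegral_comp_mul_rpow hv hr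
        (fun s => ENNReal.ofReal (s ^ (b / p₀ - 1)) * g s ^ b),
        ← lintegral_const_mul' _ _ ENNReal.ofReal_ne_top]
      refine setLIntegral_congr_fun measurableSet_Ioi fun t ht => ?_
      have ht0 : (0 : ℝ) < t := ht
      rw [ENNReal.mul_rpow_of_nonneg _ _ hb0.le,
        ENNReal.ofReal_rpow_of_nonneg (by positivity) hb0.le, ← mul_assoc, ← mul_assoc, ← mul_assoc,
        ← ENNReal.ofReal_mul (by positivity), ← ENNReal.ofReal_mul (by positivity),
        ← ENNReal.ofReal_mul (by positivity), mul_comm v (t ^ r)]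
      congr 2
      rw [Real.mul_rpow (by positivity) hv.le, ← Real.rpow_mul hv.le, ← Real.rpow_mul ht0.le]
      have e1 : v * v ^ (b / p₀ - 1) = v ^ (1 / p₀ * b) := by
        rw [Real.rpow_sub_one hv.ne']; field_simp
      have e2 : t ^ (r - 1) * t ^ (r * (b / p₀ - 1)) = t ^ (r * b / p₀ - 1) := by
        rw [← Real.rpow_add ht0]; congr 1; ring
      rw [← e1, ← e2]
      field_simp
    calc ∫⁻ t in Set.Ioi (0 : ℝ), ENNReal.ofReal (t ^ (b / p₁ - 1)) * stieltjes q g (t ^ r) ^ b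
        ≤ ∫⁻ t in Set.Ioi (0 : ℝ), K ^ (b - 1) * ∫⁻ v in Set.Ioi (0 : ℝ), w v *
            (ENNReal.ofReal (t ^ (r * b / p₀ - 1)) *
              (ENNReal.ofReal (v ^ (1 / p₀)) * g (t ^ r * v)) ^ b) := by
          refine setLIntegral_mono' measurableSet_Ioi fun t ht => ?_
          have ht0 : (0 : ℝ) < t := ht
          have htr : 0 < t ^ r := Real.rpow_pos_of_pos ht0 r
          rw [stieltjes_eq_scale p₀ g htr, ENNReal.mul_rpow_of_nonneg _ _ hb0.le]
          have hJ := lintegral_mul_rpow_le (μ := volume.restrict (Set.Ioi (0 : ℝ))) hb hwm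
            (hG (t ^ r))
          calc _ ≤ ENNReal.ofReal (t ^ (b / p₁ - 1)) * (ENNReal.ofReal ((t ^ r) ^ (1 / q)) ^ b *
                (K ^ (b - 1) * ∫⁻ v in Set.Ioi (0 : ℝ), w v *
                  (ENNReal.ofReal (v ^ (1 / p₀)) * g (t ^ r * v)) ^ b)) := by gcongr
            _ = K ^ (b - 1) * (ENNReal.ofReal (t ^ (r * b / p₀ - 1)) *
                ∫⁻ v in Set.Ioi (0 : ℝ), w v *
                  (ENNReal.ofReal (v ^ (1 / p₀)) * g (t ^ r * v)) ^ b) := by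
                have : ENNReal.ofReal (t ^ (r * b / p₀ - 1)) = ENNReal.ofReal (t ^ (b / p₁ - 1)) *
                    ENNReal.ofReal ((t ^ r) ^ (1 / q)) ^ b := by
                  rw [ENNReal.ofReal_rpow_of_nonneg (by positivity) hb0.le,
                    ← ENNReal.ofReal_mul (by positivity), ← Real.rpow_mul ht0.le,
                    ← Real.rpow_mul ht0.le, ← Real.rpow_add ht0]
                  congr 2
                  linear_combination b * hrel
                rw [this]; ring
            _ ≤ _ := by
                rw [← lintegral_const_mul' _ _ ENNReal.ofReal_ne_top]
                refine mul_le_mul_right (lintegral_mono fun v => le_of_eq ?_) _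
                ring
      _ = K ^ (b - 1) * ∫⁻ v in Set.Ioi (0 : ℝ), ∫⁻ t in Set.Ioi (0 : ℝ), w v *
            (ENNReal.ofReal (t ^ (r * b / p₀ - 1)) *
              (ENNReal.ofReal (v ^ (1 / p₀)) * g (t ^ r * v)) ^ b) := by
          rw [lintegral_const_mul' _ _ hKb, lintegral_lintegral_swap]
          exact Measurable.aemeasurable (by unfold Function.uncurry; fun_prop)
      _ = K ^ (b - 1) * ∫⁻ v in Set.Ioi (0 : ℝ), w v * (ENNReal.ofReal (1 / r) * N) := by
          congr 1
          refine setLIntegral_congr_fun measurableSet_Ioi fun v hv => ?_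
          rw [lintegral_const_mul' _ _ ENNReal.ofReal_ne_top, hinner v hv]
      _ = ENNReal.ofReal (1 / r) * K ^ b * N := by
          rw [lintegral_mul_const _ hwm, ← hKdef]
          have : K ^ b = K ^ (b - 1) * K := by
            conv_lhs => rw [← sub_add_cancel b 1]
            rw [ENNReal.rpow_add_of_nonneg _ _ (by linarith) zero_le_one, ENNReal.rpow_one]
          rw [this]; ring

end Stieltjes

/-! ### The exponent r. -/

section Slope

variable {p₀ p₁ q : ℝ}

lemma slope_pos (hp₀ : 1 < p₀) (hq : p₀ < q) (hp₁ : 1 < p₁) : 0 < slope p₀ p₁ q := by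
  have h1 : 0 < q - p₀ := by linarith
  have h2 : 0 < p₁ := by linarith
  have h3 : 0 < p₀ := by linarith
  have h4 : 0 < q := by linarith
  unfold slope; positivity

/-- Equivalently a^{1/p₀} = t^{1/p₁} a^{1/q} for a = t^r. Apart from positivity, this is the only
property of r that is used. -/
lemma slope_div (hp₀ : 1 < p₀) (hq : p₀ < q) (hp₁ : 1 < p₁) :
    slope p₀ p₁ q / p₀ = 1 / p₁ + slope p₀ p₁ q / q := by
  have h1 : q - p₀ ≠ 0 := by linarith
  have h2 : p₁ ≠ 0 := by linarith
  have h3 : p₀ ≠ 0 := by linarith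
  have h4 : q ≠ 0 := by linarith
  unfold slope; field_simp; ring

end Slope

/-! ### Measurability on the representation interval. -/

section RepMeasurability

variable {β : Type*} [MeasurableSpace β] {ν : Measure β}

lemma ae_repMeasure (ν : Measure β) :
    ∀ᵐ t ∂repMeasure ν, 0 < t ∧ ENNReal.ofReal t < ν Set.univ :=
  ae_restrict_mem (measurableSet_repInterval _)

/-- Monotonicity in t supplies the measurability that the norm axioms require, including the case
where the Lorentz functional is a supremum. -/
lemma aemeasurable_rpow_mul_of_monotoneOn {ψ : ℝ → ℝ≥0∞} (hψ : MonotoneOn ψ (Set.Ioi 0)) (e : ℝ) :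
    AEMeasurable (fun t => ENNReal.ofReal (t ^ e) * ψ t) (repMeasure ν) := by
  refine AEMeasurable.mul (by fun_prop) ?_
  exact aemeasurable_restrict_of_monotoneOn (measurableSet_repInterval _)
    (hψ.mono fun t ht => ht.1)

lemma monotoneOn_lorentzFunctional_Ioc {p r : ℝ} {q₀ : ℝ≥0∞} (h1 : 1 ≤ q₀) (hr : 0 < r)
    (g : ℝ → ℝ≥0∞) :
    MonotoneOn (fun t : ℝ => lorentzFunctional p q₀ (Set.Ioc 0 (t ^ r)) g) (Set.Ioi 0) := by
  intro s hs t _ hst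
  refine lorentzFunctional_mono h1 measurableSet_Ioc measurableSet_Ioc fun u hu _ => ⟨⟨hu.1, ?_⟩, le_rfl⟩
  exact hu.2.trans (Real.rpow_le_rpow (le_of_lt hs) hst hr.le)

lemma aemeasurable_calderonR (m : Measure ℝ) {p₀ p₁ q : ℝ} {q₀ : ℝ≥0∞} (h1 : 1 ≤ q₀)
    (hr : 0 < slope p₀ p₁ q) (f : ℝ → ℝ≥0∞) :
    AEMeasurable (calderonR m p₀ p₁ q q₀ f) (repMeasure ν) :=
  aemeasurable_rpow_mul_of_monotoneOn (monotoneOn_lorentzFunctional_Ioc h1 hr _) _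

lemma aemeasurable_calderonS (m : Measure ℝ) {p₀ p₁ q : ℝ} (hr : 0 < slope p₀ p₁ q)
    (f : ℝ → ℝ≥0∞) : AEMeasurable (calderonS m p₀ p₁ q f) (repMeasure ν) := by
  refine aemeasurable_restrict_of_antitoneOn (measurableSet_repInterval _) fun s hs t _ hst => ?_
  exact lintegral_mono_set (Set.Ioi_subset_Ioi (Real.rpow_le_rpow hs.1.le hst hr.le))

lemma aemeasurable_angle {p : ℝ} {q₀ : ℝ≥0∞} (h1 : 1 ≤ q₀) (g : ℝ → ℝ≥0∞) :
    AEMeasurable (fun t => ENNReal.ofReal (t ^ (-1 / p)) * lorentzFunctional p q₀ (Set.Ioc 0 t) g)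
      (repMeasure ν) := by
  refine aemeasurable_rpow_mul_of_monotoneOn ?_ _
  have := monotoneOn_lorentzFunctional_Ioc (p := p) h1 one_pos g
  simpa only [Real.rpow_one] using this

end RepMeasurability

/-! ### Truncation and membership in the sum space. -/

section Truncation

variable {α : Type*} [MeasurableSpace α] {μ : Measure α}

lemma abs_clamp_le (L x : ℝ) (hL : 0 ≤ L) :
    |max (-L) (min x L)| ≤ |x| ∧ |max (-L) (min x L)| ≤ L ∧ |x - max (-L) (min x L)| ≤ |x| ∧
      (|x| ≤ L → x - max (-L) (min x L) = 0) := by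
  rcases le_total x L with h1 | h1
  · rcases le_total (-L) x with h2 | h2
    · simp [h1, h2, abs_le.2 ⟨h2, h1⟩]
    · rw [min_eq_left h1, max_eq_left h2, abs_of_nonpos (by linarith : x ≤ 0),
        abs_of_nonpos (by linarith : -L ≤ 0), abs_of_nonpos (by linarith : x - -L ≤ 0)]
      exact ⟨by linarith, by linarith, by linarith, fun h => by linarith⟩
  · rw [min_eq_right h1, max_eq_right (by linarith), abs_of_nonneg (by linarith : 0 ≤ x),
      abs_of_nonneg hL, abs_of_nonneg (by linarith : 0 ≤ x - L)]
    exact ⟨by linarith, by linarith, by linarith, fun h => by linarith⟩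

/-- Every function splits at a level into a part of small support and a bounded part. -/
lemma exists_truncation (f : α →ₘ[μ] ℝ) {l : ℝ≥0∞} (hl : l ≠ ∞) :
    ∃ f₀ f₁ : α →ₘ[μ] ℝ, f = f₀ + f₁ ∧ ∀ᵐ x ∂μ, ‖f₁ x‖ₑ ≤ ‖f x‖ₑ ∧ ‖f₁ x‖ₑ ≤ l ∧
      ‖f₀ x‖ₑ ≤ ‖f x‖ₑ ∧ (‖f x‖ₑ ≤ l → ‖f₀ x‖ₑ = 0) := by
  have hc : Continuous fun x : ℝ => max (-l.toReal) (min x l.toReal) := by fun_prop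
  refine ⟨f - AEEqFun.comp _ hc f, AEEqFun.comp _ hc f, (sub_add_cancel _ _).symm, ?_⟩
  filter_upwards [AEEqFun.coeFn_comp _ hc f, AEEqFun.coeFn_sub f (AEEqFun.comp _ hc f)]
    with x h1 h2
  obtain ⟨a1, a2, a3, a4⟩ := abs_clamp_le l.toReal (f x) ENNReal.toReal_nonneg
  simp only [Function.comp_apply] at h1
  rw [h2, Pi.sub_apply, h1]
  simp only [Real.enorm_eq_ofReal_abs]
  refine ⟨ENNReal.ofReal_le_ofReal a1, ENNReal.ofReal_le_of_le_toReal a2,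
    ENNReal.ofReal_le_ofReal a3, fun h => ?_⟩
  rw [a4 ((ENNReal.ofReal_le_iff_le_toReal hl).1 h)]
  simp

lemma lorentzNorm_zero {p : ℝ} {q₀ : ℝ≥0∞} (h1 : 1 ≤ q₀) :
    lorentzNorm μ p q₀ (0 : α →ₘ[μ] ℝ) = 0 := by
  have : rearr μ (fun x => ‖(0 : α →ₘ[μ] ℝ) x‖ₑ) = fun t => 0 * (0 : ℝ≥0∞) := by
    ext t
    rw [zero_mul]
    refine nonpos_iff_eq_zero.1 ((rearr_mono (g := fun _ => 0) ?_ t).trans ?_)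
    · filter_upwards [AEEqFun.coeFn_zero (α := α) (β := ℝ) (μ := μ)] with x hx
      simp [hx]
    · rw [rearr_le_iff]; simp
  rw [lorentzNorm, this, lorentzFunctional_const_mul h1 _ (fun _ => 0) ENNReal.zero_ne_top,
    zero_mul]

lemma memSum_left {p₀ q : ℝ} {q₀ : ℝ≥0∞} {f : α →ₘ[μ] ℝ} (h : lorentzNorm μ p₀ q₀ f < ∞) :
    MemSum μ p₀ q q₀ f :=
  ⟨f, 0, (add_zero f).symm, h, by rw [lorentzNorm_zero le_rfl]; exact ENNReal.zero_lt_top⟩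

lemma memSum_right {p₀ q : ℝ} {q₀ : ℝ≥0∞} (h1 : 1 ≤ q₀) {f : α →ₘ[μ] ℝ}
    (h : lorentzNorm μ q 1 f < ∞) : MemSum μ p₀ q q₀ f :=
  ⟨0, f, (zero_add f).symm, by rw [lorentzNorm_zero h1]; exact ENNReal.zero_lt_top, h⟩

lemma lorentzNorm_one (q : ℝ) (f : α → ℝ) :
    lorentzNorm μ q 1 f = ∫⁻ s in Set.Ioi (0 : ℝ), ENNReal.ofReal (s ^ (1 / q - 1)) *
      rearr μ (fun x => ‖f x‖ₑ) s := by
  rw [lorentzNorm, lorentzFunctional_of_ne_top ENNReal.one_ne_top]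
  simp

/-- Used with M the essential supremum of the image of the bounded part, so that only the image of
the other part is rearranged. -/
lemma rearr_le_mul_add {u v : α → ℝ≥0∞} {K M : ℝ≥0∞} (h : ∀ᵐ x ∂μ, u x ≤ K * (v x + M)) (t : ℝ) :
    rearr μ u t ≤ K * (rearr μ v t + M) := by
  rw [rearr_le_iff]
  refine (measure_mono_ae (t := {x | rearr μ v t < v x}) ?_).trans (rearr_le_iff.1 le_rfl)
  filter_upwards [h] with x hx hlt
  have hlt' : K * (rearr μ v t + M) < u x := hlt
  change rearr μ v t < v x
  by_contra hcon
  refine absurd (hlt'.trans_le hx) (not_lt.2 ?_)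
  gcongr
  exact not_lt.1 hcon

end Truncation

/-! ### From the Calderón operators to quasilinear operators. -/

section UpperBound

variable {α β : Type*} [MeasurableSpace α] [MeasurableSpace β] {μ : Measure α} {ν : Measure β}
  {p₀ p₁ q : ℝ} {q₀ : ℝ≥0∞}

/-- The pointwise estimate of the averaged rearrangement of `T f` by the Calderón operators. -/
theorem angle_le_calderon (hp₀ : 1 < p₀) (hq : p₀ < q) (hp₁ : 1 < p₁) (h1 : 1 ≤ q₀)
    {T : (α →ₘ[μ] ℝ) → (β →ₘ[ν] ℝ)} (hT : QuasilinearOn (MemSum μ p₀ q q₀) T)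
    (hb : EndpointBounded p₀ p₁ q q₀ q₀ T) :
    ∃ C : ℝ≥0, ∀ (f : α →ₘ[μ] ℝ) (t : ℝ), 0 < t →
      ENNReal.ofReal (t ^ (-1 / p₁)) *
          lorentzFunctional p₁ q₀ (Set.Ioc 0 t) (rearr ν fun y => ‖T f y‖ₑ) ≤
        C * (ENNReal.ofReal (t ^ (-1 / p₁)) *
            lorentzFunctional p₀ q₀ (Set.Ioc 0 (t ^ slope p₀ p₁ q)) (rearr μ fun x => ‖f x‖ₑ) +
          ∫⁻ s in Set.Ioi (t ^ slope p₀ p₁ q), ENNReal.ofReal (s ^ (1 / q - 1)) *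
            rearr μ (fun x => ‖f x‖ₑ) s) := by
  obtain ⟨⟨k, hk⟩, -⟩ := hT
  obtain ⟨⟨C₀, hC₀⟩, C₁, hC₁⟩ := hb
  obtain ⟨κ₀, hκ₀, hconst₀⟩ := lorentzFunctional_const (p := p₀) (by linarith) h1
  obtain ⟨κ₁, -, hconst₁⟩ := lorentzFunctional_const (p := p₁) (by linarith) h1
  have hr := slope_pos hp₀ hq hp₁
  have hrel := slope_div hp₀ hq hp₁
  set r := slope p₀ p₁ q
  have hq0 : 0 < q := by linarith
  let C : ℝ≥0 := 2 * ‖k‖₊ * (C₀ + κ₁ * (C₁ * (q.toNNReal * κ₀⁻¹ + 1)))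
  -- The added 1 keeps the constant nonzero, so that the case of an infinite right-hand side is
  -- trivial despite 0 · ∞ = 0.
  refine ⟨C + 1, fun f t ht => ?_⟩
  set F := rearr μ fun x => ‖f x‖ₑ with hF
  set a := t ^ r with ha_def
  have ha : 0 < a := Real.rpow_pos_of_pos ht r
  set A := lorentzFunctional p₀ q₀ (Set.Ioc 0 a) F with hA
  set B := ∫⁻ s in Set.Ioi a, ENNReal.ofReal (s ^ (1 / q - 1)) * F s with hB
  set ρ := ENNReal.ofReal (t ^ (-1 / p₁)) with hρ
  have hρ0 : ρ ≠ 0 := by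
    rw [hρ]; simpa using Real.rpow_pos_of_pos ht _
  rcases eq_or_ne (ρ * A + B) ∞ with htop | hfin
  · rw [htop, ENNReal.mul_top (by simp)]; exact le_top
  obtain ⟨hρA, hBfin⟩ := ENNReal.add_ne_top.1 hfin
  have hAfin : A ≠ ∞ := fun h => hρA (by rw [h, ENNReal.mul_top hρ0])
  have hlevel : κ₀ * (ENNReal.ofReal (a ^ (1 / p₀)) * F a) ≤ A := by
    rw [← hconst₀ a ha]
    exact lorentzFunctional_mono h1 measurableSet_Ioc measurableSet_Ioc
      fun s hs _ => ⟨hs, rearr_antitone _ _ hs.2⟩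
  have hl : F a ≠ ∞ := by
    intro h
    rw [h, ENNReal.mul_top (by simpa using Real.rpow_pos_of_pos ha _),
      ENNReal.mul_top (by simpa using hκ₀)] at hlevel
    exact hAfin (top_le_iff.1 hlevel)
  obtain ⟨f₀, f₁, hsum, htr⟩ := exists_truncation f hl
  -- The part `f₀` is nonzero only where |f| > F a, a set of measure at most a, so its rearrangement
  -- vanishes from a on.
  have hf₀ : lorentzNorm μ p₀ q₀ f₀ ≤ A := by
    refine lorentzFunctional_mono h1 measurableSet_Ioi measurableSet_Ioc fun s hs hne => ⟨⟨hs, ?_⟩,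
      rearr_mono (htr.mono fun x hx => hx.2.2.1) s⟩
    by_contra hcon
    refine hne (nonpos_iff_eq_zero.1 (rearr_le_iff.2 ?_))
    calc μ {x | 0 < ‖f₀ x‖ₑ} ≤ μ {x | F a < ‖f x‖ₑ} := by
          refine measure_mono_ae ?_
          filter_upwards [htr] with x hx h0
          change F a < _
          by_contra hle
          exact (ne_of_gt h0) (hx.2.2.2 (not_lt.1 hle))
      _ ≤ ENNReal.ofReal a := rearr_le_iff.1 le_rfl
      _ ≤ ENNReal.ofReal s := ENNReal.ofReal_le_ofReal (not_le.1 hcon).le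
  have hf₁ : lorentzNorm μ q 1 f₁ ≤ ENNReal.ofReal q * (ENNReal.ofReal (a ^ (1 / q)) * F a) + B := by
    rw [lorentzNorm_one, ← Set.Ioc_union_Ioi_eq_Ioi ha.le]
    refine (lintegral_union_le _ _ _).trans (add_le_add ?_ ?_)
    · calc _ ≤ ∫⁻ s in Set.Ioc 0 a, ENNReal.ofReal (s ^ (1 / q - 1)) * F a := by
            refine lintegral_mono fun s => ?_
            gcongr
            have h0 : μ {x | F a < ‖f₁ x‖ₑ} = 0 := by
              simpa only [not_le] using ae_iff.1 (htr.mono fun x hx => hx.2.1)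
            rw [rearr_le_iff, h0]
            exact zero_le
        _ = _ := by
            rw [lintegral_mul_const _ (by fun_prop), setLIntegral_Ioc_rpow ha (by positivity),
              ← mul_assoc, ← ENNReal.ofReal_mul hq0.le]
            congr 2
            field_simp
    · refine lintegral_mono fun s => ?_
      gcongr
      exact rearr_mono (htr.mono fun x hx => hx.1) s
  have hf₀fin : lorentzNorm μ p₀ q₀ f₀ < ∞ := hf₀.trans_lt (lt_top_iff_ne_top.2 hAfin)
  have hf₁fin : lorentzNorm μ q 1 f₁ < ∞ := by
    refine hf₁.trans_lt (ENNReal.add_lt_top.2 ⟨?_, lt_top_iff_ne_top.2 hBfin⟩)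
    exact ENNReal.mul_lt_top ENNReal.ofReal_lt_top
      (ENNReal.mul_lt_top ENNReal.ofReal_lt_top (lt_top_iff_ne_top.2 hl))
  have hTsum : ∀ᵐ y ∂ν, ‖T f y‖ₑ ≤ (‖k‖₊ : ℝ≥0∞) * (‖T f₀ y‖ₑ + eLpNorm (T f₁) ∞ ν) := by
    filter_upwards [hk f₀ f₁ (memSum_left hf₀fin) (memSum_right h1 hf₁fin),
      enorm_ae_le_eLpNormEssSup (T f₁) ν] with y hy hy1
    rw [← hsum] at hy
    rw [eLpNorm_exponent_top]
    refine le_trans ?_ (mul_le_mul_right (add_le_add_right hy1 _) _)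
    have h2 : |T f y| ≤ ‖k‖ * (|T f₀ y| + |T f₁ y|) :=
      hy.trans (mul_le_mul_of_nonneg_right (le_abs_self k) (by positivity))
    have h3 : (‖k‖₊ : ℝ≥0∞) = ENNReal.ofReal ‖k‖ := by
      rw [ofReal_norm, enorm_eq_nnnorm]
    rw [h3]
    simp only [Real.enorm_eq_ofReal_abs]
    rw [← ENNReal.ofReal_add (abs_nonneg _) (abs_nonneg _), ← ENNReal.ofReal_mul (norm_nonneg _)]
    exact ENNReal.ofReal_le_ofReal h2
  have hρt : ρ * ENNReal.ofReal (t ^ (1 / p₁)) = 1 := by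
    rw [hρ, ← ENNReal.ofReal_mul (by positivity), ← Real.rpow_add ht]
    simp [neg_div]
  -- The relation for r gives a^{1/q} = t^{-1/p₁} a^{1/p₀}, so the contribution of the truncation
  -- level is absorbed by the R term.
  have hmid : ENNReal.ofReal (a ^ (1 / q)) * F a ≤ (κ₀⁻¹ : ℝ≥0) * (ρ * A) := by
    have e1 : ENNReal.ofReal (a ^ (1 / q)) = ρ * ENNReal.ofReal (a ^ (1 / p₀)) := by
      rw [hρ, ← ENNReal.ofReal_mul (by positivity), ha_def, ← Real.rpow_mul ht.le,
        ← Real.rpow_mul ht.le, ← Real.rpow_add ht]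
      congr 2
      linear_combination -hrel
    have e2 : ((κ₀⁻¹ : ℝ≥0) : ℝ≥0∞) * κ₀ = 1 := by
      rw [← ENNReal.coe_mul, inv_mul_cancel₀ hκ₀, ENNReal.coe_one]
    calc _ = (κ₀⁻¹ : ℝ≥0) * (ρ * (κ₀ * (ENNReal.ofReal (a ^ (1 / p₀)) * F a))) := by
          rw [e1]
          calc _ = (((κ₀⁻¹ : ℝ≥0) : ℝ≥0∞) * κ₀) * (ρ * ENNReal.ofReal (a ^ (1 / p₀)) * F a) := by
                rw [e2, one_mul]
            _ = _ := by ring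
      _ ≤ _ := by gcongr
  set M := eLpNorm (T f₁) ∞ ν with hM
  have hMle : M ≤ C₁ * (ENNReal.ofReal q * ((κ₀⁻¹ : ℝ≥0) * (ρ * A)) + B) :=
    (hC₁ f₁ hf₁fin).trans (by gcongr; exact hf₁.trans (by gcongr))
  have hmain : lorentzFunctional p₁ q₀ (Set.Ioc 0 t) (rearr ν fun y => ‖T f y‖ₑ) ≤
      ‖k‖₊ * (2 * (C₀ * A + κ₁ * (ENNReal.ofReal (t ^ (1 / p₁)) * M))) := by
    calc _ ≤ lorentzFunctional p₁ q₀ (Set.Ioc 0 t)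
          (fun s => ‖k‖₊ * (rearr ν (fun y => ‖T f₀ y‖ₑ) s + M)) :=
          lorentzFunctional_mono h1 measurableSet_Ioc measurableSet_Ioc
            fun s hs _ => ⟨hs, rearr_le_mul_add hTsum s⟩
      _ = ‖k‖₊ * lorentzFunctional p₁ q₀ (Set.Ioc 0 t)
          (fun s => rearr ν (fun y => ‖T f₀ y‖ₑ) s + M) :=
          lorentzFunctional_const_mul h1 _ _ ENNReal.coe_ne_top
      _ ≤ ‖k‖₊ * (2 * (lorentzFunctional p₁ q₀ (Set.Ioc 0 t) (rearr ν (fun y => ‖T f₀ y‖ₑ)) +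
          lorentzFunctional p₁ q₀ (Set.Ioc 0 t) (fun _ => M))) := by
          gcongr
          exact lorentzFunctional_add_le h1 _ (measurable_rearr _ _) _
      _ ≤ _ := by
          rw [hconst₁ t ht]
          gcongr
          calc _ ≤ lorentzNorm ν p₁ q₀ (T f₀) :=
                lorentzFunctional_mono h1 measurableSet_Ioc measurableSet_Ioi
                  fun s hs _ => ⟨hs.1, le_rfl⟩
            _ ≤ _ := (hC₀ f₀ hf₀fin).trans (by gcongr)
  have hqn : ENNReal.ofReal q = (q.toNNReal : ℝ≥0∞) := rfl
  calc ρ * lorentzFunctional p₁ q₀ (Set.Ioc 0 t) (rearr ν fun y => ‖T f y‖ₑ)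
      ≤ ρ * (‖k‖₊ * (2 * (C₀ * A + κ₁ * (ENNReal.ofReal (t ^ (1 / p₁)) * M)))) := by gcongr
    _ = 2 * ‖k‖₊ * (C₀ * (ρ * A) + κ₁ * ((ρ * ENNReal.ofReal (t ^ (1 / p₁))) * M)) := by ring
    _ ≤ 2 * ‖k‖₊ * (C₀ * (ρ * A) + κ₁ * (C₁ * (q.toNNReal * ((κ₀⁻¹ : ℝ≥0) * (ρ * A)) + B))) := by
        rw [hρt, one_mul, ← hqn]; gcongr
    _ ≤ 2 * ‖k‖₊ * (C₀ * (ρ * A + B) + κ₁ * (C₁ * (q.toNNReal * ((κ₀⁻¹ : ℝ≥0) * (ρ * A + B)) +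
          (ρ * A + B)))) := by
        gcongr <;> first | exact le_self_add | exact le_add_self
    _ = C * (ρ * A + B) := by
        simp only [C]; push_cast; ring
    _ ≤ _ := by gcongr; exact le_self_add

/-- Boundedness of the Calderón operators implies that of all quasilinear operators. -/
theorem boundedToAngle_of_boundedRep [SigmaFinite μ] [SigmaFinite ν] (hμ : NonAtomic μ)
    (hν : NonAtomic ν) (hp₀ : 1 < p₀) (hq : p₀ < q) (hp₁ : 1 < p₁) (h1 : 1 ≤ q₀) {X : RINorm μ}
    {Y : RINorm ν} (hR : BoundedRep X Y (calderonR (repMeasure μ) p₀ p₁ q q₀))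
    (hS : BoundedRep X Y (calderonS (repMeasure μ) p₀ p₁ q))
    {T : (α →ₘ[μ] ℝ) → (β →ₘ[ν] ℝ)} (hT : QuasilinearOn (MemSum μ p₀ q q₀) T)
    (hb : EndpointBounded p₀ p₁ q q₀ q₀ T) : BoundedToAngle X Y p₁ q₀ T := by
  obtain ⟨σ, hσ⟩ := exists_measurePreserving hμ
  obtain ⟨τ, hτ⟩ := exists_measurePreserving hν
  obtain ⟨C, hC⟩ := angle_le_calderon hp₀ hq hp₁ h1 hT hb
  obtain ⟨CR, hCR⟩ := hR
  obtain ⟨CS, hCS⟩ := hS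
  have hr := slope_pos hp₀ hq hp₁
  refine ⟨C * (CR + CS), fun f hf => ?_⟩
  set h := rearr μ fun x => ‖f x‖ₑ with hh
  have hm : Measurable h := measurable_rearr _ _
  have hfm : AEMeasurable (fun x => ‖f x‖ₑ) μ := f.aestronglyMeasurable.enorm
  have hnorm : X.repNorm h = X.norm fun x => ‖f x‖ₑ := by
    rw [repNorm_eq hσ X hm.aemeasurable]
    refine X.norm_eq_of_rearr_eq _ _ (hm.comp hσ.measurable).aemeasurable hfm fun t _ => ?_
    rw [rearr_comp hσ hm.aemeasurable, hh, rearr_rearr]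
  have hfin : X.repNorm h < ∞ := hnorm ▸ hf
  have mR := aemeasurable_calderonR (ν := ν) (repMeasure μ) h1 hr h
  have mS := aemeasurable_calderonS (ν := ν) (repMeasure μ) hr h
  have mR' := mR.comp_quasiMeasurePreserving hτ.quasiMeasurePreserving
  have mS' := mS.comp_quasiMeasurePreserving hτ.quasiMeasurePreserving
  have mA := aemeasurable_angle (ν := ν) (p := p₁) h1 (rearr ν fun y => ‖T f y‖ₑ)
  have bR := hCR h hm.aemeasurable hfin
  have bS := hCS h hm.aemeasurable hfin
  rw [repNorm_eq hτ Y mR] at bR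
  rw [repNorm_eq hτ Y mS] at bS
  rw [RINorm.angleNorm, repNorm_eq hτ Y mA]
  calc _ ≤ Y.norm (fun y => C * (calderonR (repMeasure μ) p₀ p₁ q q₀ h (τ y) +
          calderonS (repMeasure μ) p₀ p₁ q h (τ y))) := by
        refine Y.norm_mono _ _ (mA.comp_quasiMeasurePreserving hτ.quasiMeasurePreserving)
          ((mR'.add mS').const_mul _) ?_
        filter_upwards [hτ.quasiMeasurePreserving.ae (ae_repMeasure ν)] with y hy
        have := hC f (τ y) hy.1
        simpa only [calderonR, calderonS, hh, rearr_rearr] using this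
    _ = C * Y.norm (fun y => calderonR (repMeasure μ) p₀ p₁ q q₀ h (τ y) +
          calderonS (repMeasure μ) p₀ p₁ q h (τ y)) := Y.norm_smul _ _ (mR'.add mS')
    _ ≤ C * (CR * X.repNorm h + CS * X.repNorm h) := by
        gcongr
        exact (Y.norm_add_le _ _ mR' mS').trans (add_le_add bR bS)
    _ = _ := by rw [hnorm]; push_cast; ring

end UpperBound

/-! ### Lower bounds and finiteness of the Stieltjes type integral. -/

section StieltjesLower

variable {q : ℝ}

/-- For s > a, s + a ≤ 2 s. This is the half that controls S. -/
lemma setLIntegral_Ioi_le_stieltjes (hq : 1 < q) (F : ℝ → ℝ≥0∞) {a : ℝ} (ha : 0 < a) :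
    ∫⁻ s in Set.Ioi a, ENNReal.ofReal (s ^ (1 / q - 1)) * F s ≤
      ENNReal.ofReal (2 ^ (1 - 1 / q)) * stieltjes q F a := by
  have h1 : 1 / q - 1 ≤ 0 := by
    have : 1 / q < 1 := by rw [div_lt_one (by linarith)]; exact hq
    linarith
  rw [stieltjes, ← lintegral_const_mul' _ _ ENNReal.ofReal_ne_top]
  refine le_trans (setLIntegral_mono' measurableSet_Ioi fun s hs => ?_)
    (lintegral_mono_set (Set.Ioi_subset_Ioi ha.le))
  have has : a < s := hs
  have hs0 : 0 < s := ha.trans has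
  rw [← mul_assoc, ← ENNReal.ofReal_mul (by positivity)]
  gcongr ENNReal.ofReal ?_ * _
  calc s ^ (1 / q - 1) = 2 ^ (1 - 1 / q) * (2 * s) ^ (1 / q - 1) := by
        rw [Real.mul_rpow two_pos.le hs0.le, ← mul_assoc, ← Real.rpow_add two_pos]
        simp
    _ ≤ _ := by
        refine mul_le_mul_of_nonneg_left ?_ (by positivity)
        exact Real.rpow_le_rpow_of_nonpos (by positivity) (by linarith) h1

/-- On (0, a], s + a ≤ 2 a and F s ≥ F a. This is the half that controls R. -/
lemma rpow_mul_le_stieltjes (hq : 1 < q) {F : ℝ → ℝ≥0∞} (hF : Antitone F) {a : ℝ} (ha : 0 < a) :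
    ENNReal.ofReal (a ^ (1 / q)) * F a ≤ ENNReal.ofReal (2 ^ (1 - 1 / q)) * stieltjes q F a := by
  have h1 : 1 / q - 1 ≤ 0 := by
    have : 1 / q < 1 := by rw [div_lt_one (by linarith)]; exact hq
    linarith
  calc ENNReal.ofReal (a ^ (1 / q)) * F a
      = ∫⁻ _ in Set.Ioc 0 a, ENNReal.ofReal (a ^ (1 / q - 1)) * F a := by
        rw [setLIntegral_const, Real.volume_Ioc, sub_zero, mul_right_comm,
          ← ENNReal.ofReal_mul (by positivity), Real.rpow_sub_one ha.ne', div_mul_cancel₀ _ ha.ne']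
    _ ≤ ∫⁻ s in Set.Ioc 0 a, ENNReal.ofReal (2 ^ (1 - 1 / q)) *
          (ENNReal.ofReal ((s + a) ^ (1 / q - 1)) * F s) := by
        refine setLIntegral_mono' measurableSet_Ioc fun s hs => ?_
        have hs0 : 0 < s := hs.1
        rw [← mul_assoc, ← ENNReal.ofReal_mul (by positivity)]
        refine mul_le_mul' (ENNReal.ofReal_le_ofReal ?_) (hF hs.2)
        calc a ^ (1 / q - 1) = 2 ^ (1 - 1 / q) * (2 * a) ^ (1 / q - 1) := by
              rw [Real.mul_rpow two_pos.le ha.le, ← mul_assoc, ← Real.rpow_add two_pos]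
              simp
          _ ≤ _ := by
              refine mul_le_mul_of_nonneg_left ?_ (by positivity)
              exact Real.rpow_le_rpow_of_nonpos (by positivity) (by linarith [hs.2]) h1
    _ ≤ _ := by
        rw [stieltjes, ← lintegral_const_mul' _ _ ENNReal.ofReal_ne_top]
        exact lintegral_mono_set fun s hs => hs.1

lemma stieltjes_le_lorentz (hq : 1 < q) (F : ℝ → ℝ≥0∞) {a : ℝ} (ha : 0 ≤ a) :
    stieltjes q F a ≤ ∫⁻ s in Set.Ioi (0 : ℝ), ENNReal.ofReal (s ^ (1 / q - 1)) * F s := by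
  refine (stieltjes_antitoneOn hq F Set.self_mem_Ici ha ha).trans_eq ?_
  simp [stieltjes]

lemma antitoneOn_stieltjes_rpow (hq : 1 < q) (F : ℝ → ℝ≥0∞) {r : ℝ} (hr : 0 < r) :
    AntitoneOn (fun t : ℝ => stieltjes q F (t ^ r)) (Set.Ioi 0) := fun _ hs _ ht hst =>
  stieltjes_antitoneOn hq F (Real.rpow_nonneg (le_of_lt hs) _) (Real.rpow_nonneg (le_of_lt ht) _)
    (Real.rpow_le_rpow (le_of_lt hs) hst hr.le)

/-- By the Hardy type inequality a non-increasing function has finite Lorentz functional, which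
forces its values to be finite. -/
lemma stieltjes_lt_top {p₀ p₁ r : ℝ} {q₀ : ℝ≥0∞} (hp₀ : 1 < p₀) (hq : p₀ < q) (hp₁ : 1 < p₁)
    (hr : 0 < r) (hrel : r / p₀ = 1 / p₁ + r / q) (h1 : 1 ≤ q₀) {g : ℝ → ℝ≥0∞} (hg : Measurable g)
    (hfin : lorentzFunctional p₀ q₀ (Set.Ioi 0) g < ∞) {t : ℝ} (ht : 0 < t) :
    stieltjes q g (t ^ r) < ∞ := by
  obtain ⟨C, hC⟩ := lorentzFunctional_stieltjes_le hp₀ hq hr hrel h1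
  obtain ⟨κ, hκ, hconst⟩ := lorentzFunctional_const (p := p₁) (by linarith) h1
  have h2 : κ * (ENNReal.ofReal (t ^ (1 / p₁)) * stieltjes q g (t ^ r)) ≤
      C * lorentzFunctional p₀ q₀ (Set.Ioi 0) g := by
    rw [← hconst t ht]
    refine le_trans ?_ (hC g hg)
    exact lorentzFunctional_mono h1 measurableSet_Ioc measurableSet_Ioi fun s hs _ =>
      ⟨hs.1, antitoneOn_stieltjes_rpow (by linarith) g hr hs.1 ht hs.2⟩
  by_contra hcon
  rw [not_lt, top_le_iff] at hcon
  rw [hcon, ENNReal.mul_top (by simpa using Real.rpow_pos_of_pos ht _),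
    ENNReal.mul_top (by simpa using hκ), top_le_iff] at h2
  exact (ENNReal.mul_lt_top ENNReal.coe_lt_top hfin).ne h2

end StieltjesLower

/-! ### The extremal linear operator. -/

section KernelOperator

variable {α β : Type*} [MeasurableSpace α] [MeasurableSpace β] {μ : Measure α} {ν : Measure β}
  {p₀ p₁ q r : ℝ} {q₀ : ℝ≥0∞} {σ : α → ℝ} {τ : β → ℝ}

lemma stronglyMeasurable_kernel_integral [SFinite μ] (hσ : Measurable σ) (hτ : Measurable τ)
    (q r : ℝ) (g : α →ₘ[μ] ℝ) :
    StronglyMeasurable fun y => ∫ x, (σ x + τ y ^ r) ^ (1 / q - 1) * g x ∂μ := by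
  refine StronglyMeasurable.integral_prod_right (f := fun y x => (σ x + τ y ^ r) ^ (1 / q - 1) * g x)
    (Measurable.stronglyMeasurable ?_)
  have := g.measurable
  unfold Function.uncurry
  fun_prop

/-- The linear operator `g ↦ ∫ (σ(x) + τ(y)^r)^(1/q - 1) g(x) dμ(x)`. -/
noncomputable def kernelOp [SFinite μ] (ν : Measure β) (hσ : Measurable σ) (hτ : Measurable τ)
    (q r : ℝ) (g : α →ₘ[μ] ℝ) : β →ₘ[ν] ℝ :=
  AEEqFun.mk (fun y => ∫ x, (σ x + τ y ^ r) ^ (1 / q - 1) * g x ∂μ)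
    (stronglyMeasurable_kernel_integral hσ hτ q r g).aestronglyMeasurable

lemma coeFn_kernelOp [SFinite μ] (hσ : Measurable σ) (hτ : Measurable τ) (g : α →ₘ[μ] ℝ) :
    kernelOp ν hσ hτ q r g =ᵐ[ν] fun y => ∫ x, (σ x + τ y ^ r) ^ (1 / q - 1) * g x ∂μ :=
  AEEqFun.coeFn_mk _ _

lemma ae_pos (hσ : MeasurePreserving σ μ (repMeasure μ)) : ∀ᵐ x ∂μ, 0 < σ x :=
  (hσ.quasiMeasurePreserving.ae (ae_repMeasure μ)).mono fun _ h => h.1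

lemma lintegral_enorm_kernel_le [SFinite μ] (hσ : MeasurePreserving σ μ (repMeasure μ))
    (hq : 1 < q) (g : α →ₘ[μ] ℝ) {a : ℝ} (ha : 0 ≤ a) :
    ∫⁻ x, ‖(σ x + a) ^ (1 / q - 1) * g x‖ₑ ∂μ ≤ stieltjes q (rearr μ fun x => ‖g x‖ₑ) a := by
  have h1 : 1 / q - 1 ≤ 0 := by
    have : 1 / q < 1 := by rw [div_lt_one (by linarith)]; exact hq
    linarith
  have hanti : AntitoneOn (fun s : ℝ => ENNReal.ofReal ((s + a) ^ (1 / q - 1))) (Set.Ioi 0) := by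
    intro s hs t _ hst
    have hs0 : (0 : ℝ) < s := hs
    exact ENNReal.ofReal_le_ofReal (Real.rpow_le_rpow_of_nonpos (by positivity) (by linarith) h1)
  refine le_trans (le_of_eq ?_) (lintegral_comp_mul_le hσ (by fun_prop) hanti g.measurable.enorm)
  refine lintegral_congr_ae ?_
  filter_upwards [ae_pos hσ] with x hx
  rw [enorm_mul, Real.enorm_eq_ofReal (by positivity)]

/-- Each summand of `g` is handled by its own endpoint. Linearity needs this, since the integral of
a non-integrable function is 0 by convention. -/
lemma integrable_kernel [SFinite μ] (hσ : MeasurePreserving σ μ (repMeasure μ)) (hp₀ : 1 < p₀)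
    (hq : p₀ < q) (hp₁ : 1 < p₁) (hr : 0 < r) (hrel : r / p₀ = 1 / p₁ + r / q) (h1 : 1 ≤ q₀)
    {g : α →ₘ[μ] ℝ} (hg : MemSum μ p₀ q q₀ g) {t : ℝ} (ht : 0 < t) :
    Integrable (fun x => (σ x + t ^ r) ^ (1 / q - 1) * g x) μ := by
  have hσm := hσ.measurable
  have hq1 : 1 < q := by linarith
  have htr : 0 ≤ t ^ r := Real.rpow_nonneg ht.le r
  have key : ∀ f : α →ₘ[μ] ℝ, stieltjes q (rearr μ fun x => ‖f x‖ₑ) (t ^ r) < ∞ →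
      Integrable (fun x => (σ x + t ^ r) ^ (1 / q - 1) * f x) μ := by
    intro f hf
    have := f.measurable
    refine ⟨Measurable.aestronglyMeasurable (by fun_prop), ?_⟩
    exact (lintegral_enorm_kernel_le hσ hq1 f htr).trans_lt hf
  obtain ⟨g₀, g₁, rfl, hg₀, hg₁⟩ := hg
  have i₀ := key g₀ (stieltjes_lt_top hp₀ hq hp₁ hr hrel h1 (measurable_rearr _ _) hg₀ ht)
  have i₁ := key g₁ ((stieltjes_le_lorentz hq1 _ htr).trans_lt (by rwa [lorentzNorm_one] at hg₁))
  refine (i₀.add i₁).congr ?_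
  filter_upwards [AEEqFun.coeFn_add g₀ g₁] with x hx
  rw [hx, Pi.add_apply, Pi.add_apply, mul_add]

lemma linearOn_kernelOp [SFinite μ] (hσ : MeasurePreserving σ μ (repMeasure μ))
    (hτ : MeasurePreserving τ ν (repMeasure ν)) (hp₀ : 1 < p₀) (hq : p₀ < q) (hp₁ : 1 < p₁)
    (hr : 0 < r) (hrel : r / p₀ = 1 / p₁ + r / q) (h1 : 1 ≤ q₀) :
    LinearOn (MemSum μ p₀ q q₀) (kernelOp ν hσ.measurable hτ.measurable q r) := by
  refine ⟨fun f g hf hg => ?_, fun c f _ => ?_⟩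
  · refine AEEqFun.ext ?_
    filter_upwards [coeFn_kernelOp hσ.measurable hτ.measurable (f + g),
      coeFn_kernelOp hσ.measurable hτ.measurable f, coeFn_kernelOp hσ.measurable hτ.measurable g,
      AEEqFun.coeFn_add (kernelOp ν hσ.measurable hτ.measurable q r f)
        (kernelOp ν hσ.measurable hτ.measurable q r g), ae_pos hτ] with y h2 h3 h4 h5 hy
    rw [h2, h5, Pi.add_apply, h3, h4,
      ← integral_add (integrable_kernel hσ hp₀ hq hp₁ hr hrel h1 hf hy)
        (integrable_kernel hσ hp₀ hq hp₁ hr hrel h1 hg hy)]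
    refine integral_congr_ae ?_
    filter_upwards [AEEqFun.coeFn_add f g] with x hx
    rw [hx, Pi.add_apply, mul_add]
  · refine AEEqFun.ext ?_
    filter_upwards [coeFn_kernelOp hσ.measurable hτ.measurable (c • f),
      coeFn_kernelOp hσ.measurable hτ.measurable f,
      AEEqFun.coeFn_smul c (kernelOp ν hσ.measurable hτ.measurable q r f)] with y h2 h3 h5
    rw [h2, h5, Pi.smul_apply, h3, smul_eq_mul, ← integral_const_mul]
    refine integral_congr_ae ?_
    filter_upwards [AEEqFun.coeFn_smul c f] with x hx
    rw [hx, Pi.smul_apply, smul_eq_mul]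
    ring

lemma enorm_kernelOp_le [SFinite μ] (hσ : MeasurePreserving σ μ (repMeasure μ))
    (hτ : MeasurePreserving τ ν (repMeasure ν)) (hq : 1 < q) (g : α →ₘ[μ] ℝ) :
    ∀ᵐ y ∂ν, ‖kernelOp ν hσ.measurable hτ.measurable q r g y‖ₑ ≤
      stieltjes q (rearr μ fun x => ‖g x‖ₑ) (τ y ^ r) := by
  filter_upwards [coeFn_kernelOp hσ.measurable hτ.measurable g, ae_pos hτ] with y h2 hy
  rw [h2]
  exact (enorm_integral_le_lintegral_enorm _).trans
    (lintegral_enorm_kernel_le hσ hq g (Real.rpow_nonneg hy.le _))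

lemma aemeasurable_stieltjes (hq : 1 < q) (hr : 0 < r) (F : ℝ → ℝ≥0∞) :
    AEMeasurable (fun t : ℝ => stieltjes q F (t ^ r)) (repMeasure ν) :=
  aemeasurable_restrict_of_antitoneOn (measurableSet_repInterval _)
    ((antitoneOn_stieltjes_rpow hq F hr).mono fun _ ht => ht.1)

/-- Both bounds come from the majorant `stieltjes q g^* (τ y ^ r)`: as a non-increasing function of
τ it falls under the Hardy type inequality, and it never exceeds its value at 0, the L^{q,1} norm.
-/
lemma endpointBounded_kernelOp [SFinite μ] (hσ : MeasurePreserving σ μ (repMeasure μ))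
    (hτ : MeasurePreserving τ ν (repMeasure ν)) (hp₀ : 1 < p₀) (hq : p₀ < q)
    (hr : 0 < r) (hrel : r / p₀ = 1 / p₁ + r / q) (h1 : 1 ≤ q₀) :
    EndpointBounded p₀ p₁ q q₀ q₀ (kernelOp (μ := μ) ν hσ.measurable hτ.measurable q r) := by
  have hq1 : 1 < q := by linarith
  constructor
  · obtain ⟨C, hC⟩ := lorentzFunctional_stieltjes_le hp₀ hq hr hrel h1
    refine ⟨C, fun g _ => le_trans ?_ (hC _ (measurable_rearr _ _))⟩
    refine lorentzFunctional_mono h1 measurableSet_Ioi measurableSet_Ioi fun s hs _ => ⟨hs, ?_⟩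
    refine (rearr_mono (enorm_kernelOp_le hσ hτ hq1 g) s).trans ?_
    rw [rearr_comp hτ (aemeasurable_stieltjes hq1 hr _)]
    exact rearr_le_of_antitoneOn (antitoneOn_stieltjes_rpow hq1 _ hr) hs
  · refine ⟨1, fun g _ => ?_⟩
    rw [ENNReal.coe_one, one_mul, eLpNorm_exponent_top, lorentzNorm_one]
    refine essSup_le_of_ae_le _ ?_
    filter_upwards [enorm_kernelOp_le (r := r) hσ hτ hq1 g, ae_pos hτ] with y hy hy0
    exact hy.trans (stieltjes_le_lorentz hq1 _ (Real.rpow_nonneg hy0.le _))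

end KernelOperator

/-! ### From linear operators to the Calderón operators. -/

section LowerBound

variable {α β : Type*} [MeasurableSpace α] [MeasurableSpace β] {μ : Measure α} {ν : Measure β}
  {p₀ p₁ q r : ℝ} {q₀ : ℝ≥0∞} {σ : α → ℝ} {τ : β → ℝ}

/-- Local control of the L¹ norm gives finiteness on each spanning set; it lets f^* ∘ σ be replaced
by a real-valued function. -/
lemma ae_lt_top_of_norm_lt_top [SigmaFinite μ] (X : RINorm μ) {u : α → ℝ≥0∞}
    (hu : AEMeasurable u μ) (h : X.norm u < ∞) : ∀ᵐ x ∂μ, u x < ∞ := by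
  have : ∀ᵐ x ∂μ, ∀ n, x ∈ spanningSets μ n → u x < ∞ := by
    rw [ae_all_iff]
    intro n
    obtain ⟨C, hC⟩ := X.lintegral_le _ (measurableSet_spanningSets μ n)
      (measure_spanningSets_lt_top μ n)
    rw [← ae_restrict_iff' (measurableSet_spanningSets μ n)]
    exact ae_lt_top' hu.restrict ((hC u hu).trans_lt (ENNReal.mul_lt_top ENNReal.coe_lt_top h)).ne
  filter_upwards [this] with x hx
  obtain ⟨n, hn⟩ := Set.mem_iUnion.1 ((iUnion_spanningSets μ).symm ▸ Set.mem_univ x)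
  exact hx n hn

lemma repNorm_le_mul (hτ : MeasurePreserving τ ν (repMeasure ν)) (Y : RINorm ν)
    {A B : ℝ → ℝ≥0∞} (hA : AEMeasurable A (repMeasure ν)) (hB : AEMeasurable B (repMeasure ν))
    (c : ℝ≥0) (h : ∀ t : ℝ, 0 < t → ENNReal.ofReal t < ν Set.univ → A t ≤ c * B t) :
    Y.repNorm A ≤ c * Y.repNorm B := by
  have hA' := hA.comp_quasiMeasurePreserving hτ.quasiMeasurePreserving
  have hB' := hB.comp_quasiMeasurePreserving hτ.quasiMeasurePreserving
  rw [repNorm_eq hτ Y hA, repNorm_eq hτ Y hB]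
  refine (Y.norm_mono _ _ hA' (hB'.const_mul _) ?_).trans_eq (Y.norm_smul c _ hB')
  filter_upwards [hτ.quasiMeasurePreserving.ae (ae_repMeasure ν)] with y hy
  exact h _ hy.1 hy.2

/-- On a non-increasing function of `σ`, the kernel operator is the Stieltjes type integral. -/
lemma enorm_kernelOp_eq [SFinite μ] (hσ : MeasurePreserving σ μ (repMeasure μ))
    (hτ : MeasurePreserving τ ν (repMeasure ν)) (hp₀ : 1 < p₀) (hq : p₀ < q) (hp₁ : 1 < p₁)
    (hr : 0 < r) (hrel : r / p₀ = 1 / p₁ + r / q) (h1 : 1 ≤ q₀) {F : ℝ → ℝ≥0∞} (hF : Measurable F)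
    (hF0 : ∀ s : ℝ, μ Set.univ ≤ ENNReal.ofReal s → F s = 0) {g : α →ₘ[μ] ℝ}
    (hg : MemSum μ p₀ q q₀ g) (hgF : ∀ᵐ x ∂μ, 0 ≤ g x ∧ ENNReal.ofReal (g x) = F (σ x)) :
    ∀ᵐ y ∂ν, ‖kernelOp ν hσ.measurable hτ.measurable q r g y‖ₑ = stieltjes q F (τ y ^ r) := by
  filter_upwards [coeFn_kernelOp hσ.measurable hτ.measurable g, ae_pos hτ] with y h2 hy
  have hyr : 0 ≤ τ y ^ r := Real.rpow_nonneg hy.le _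
  have hnn : 0 ≤ᵐ[μ] fun x => (σ x + τ y ^ r) ^ (1 / q - 1) * g x := by
    filter_upwards [ae_pos hσ, hgF] with x hx hx2
    exact mul_nonneg (Real.rpow_nonneg (by linarith) _) hx2.1
  rw [h2, Real.enorm_eq_ofReal (integral_nonneg_of_ae hnn), ofReal_integral_eq_lintegral_ofReal
    (integrable_kernel hσ hp₀ hq hp₁ hr hrel h1 hg hy) hnn]
  calc _ = ∫⁻ x, ENNReal.ofReal ((σ x + τ y ^ r) ^ (1 / q - 1)) * F (σ x) ∂μ := by
        refine lintegral_congr_ae ?_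
        filter_upwards [ae_pos hσ, hgF] with x hx hx2
        rw [ENNReal.ofReal_mul (Real.rpow_nonneg (by linarith) _), hx2.2]
    _ = ∫⁻ s, ENNReal.ofReal ((s + τ y ^ r) ^ (1 / q - 1)) * F s ∂repMeasure μ :=
        hσ.lintegral_comp (f := fun s => ENNReal.ofReal ((s + τ y ^ r) ^ (1 / q - 1)) * F s)
          (by fun_prop)
    _ = _ := by
        -- `F` vanishes from the total mass on, so the interval and the half-line give the same
        -- integral.
        rw [stieltjes, repMeasure, ← lintegral_indicator (measurableSet_repInterval _),
          ← lintegral_indicator measurableSet_Ioi]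
        refine lintegral_congr fun s => ?_
        by_cases hs : 0 < s
        · rw [Set.indicator_of_mem (Set.mem_Ioi.2 hs)]
          by_cases hs2 : ENNReal.ofReal s < μ Set.univ
          · rw [Set.indicator_of_mem (by exact ⟨hs, hs2⟩)]
          · rw [Set.indicator_of_notMem (fun h => hs2 h.2), hF0 s (not_lt.1 hs2), mul_zero]
        · rw [Set.indicator_of_notMem (fun h => hs h.1),
            Set.indicator_of_notMem (fun h => hs (Set.mem_Ioi.1 h))]

/-- The rearrangement is compared with a value slightly to the right, at s' in (s, 2s] still inside
the interval; going back to s by `stieltjes_mul` costs (2^r)^{1-1/q}. -/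
lemma stieltjes_le_rearr (hq : 1 < q) (hr : 0 < r) (F : ℝ → ℝ≥0∞) {s : ℝ} (hs : 0 < s)
    (hsν : ENNReal.ofReal s < ν Set.univ) :
    stieltjes q F (s ^ r) ≤ ENNReal.ofReal ((2 ^ r) ^ (1 - 1 / q)) *
      rearr (repMeasure ν) (fun t => stieltjes q F (t ^ r)) s := by
  have h1 : 0 ≤ 1 - 1 / q := by
    have : 1 / q < 1 := by rw [div_lt_one (by linarith)]; exact hq
    linarith
  obtain ⟨s', hss', hs2, hs'ν⟩ : ∃ s', s < s' ∧ s' ≤ 2 * s ∧ ENNReal.ofReal s' < ν Set.univ := by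
    obtain ⟨c, hc1, hc2⟩ := ENNReal.lt_iff_exists_nnreal_btwn.1 hsν
    have hsc : s < c := by
      rw [← ENNReal.ofReal_coe_nnreal] at hc1
      exact (ENNReal.ofReal_lt_ofReal_iff_of_nonneg hs.le).1 hc1
    refine ⟨min c (2 * s), lt_min hsc (by linarith), min_le_right _ _, ?_⟩
    refine (ENNReal.ofReal_le_ofReal (min_le_left _ _)).trans_lt ?_
    rwa [ENNReal.ofReal_coe_nnreal]
  have hs'0 : 0 < s' := hs.trans hss'
  have hc : 1 ≤ (s' / s) ^ r := Real.one_le_rpow ((one_le_div hs).2 hss'.le) hr.le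
  have hmul : (s' / s) ^ r * s ^ r = s' ^ r := by
    rw [← Real.mul_rpow (by positivity) hs.le, div_mul_cancel₀ _ hs.ne']
  have h2 := stieltjes_mul hq F (Real.rpow_pos_of_pos hs r) hc
  rw [hmul] at h2
  refine h2.trans (mul_le_mul' (ENNReal.ofReal_le_ofReal ?_) ?_)
  · refine Real.rpow_le_rpow (by positivity) (Real.rpow_le_rpow (by positivity) ?_ hr.le) h1
    rw [div_le_iff₀ hs]; exact hs2
  · exact le_rearr_of_antitoneOn (antitoneOn_stieltjes_rpow hq F hr) hs hss' hs'ν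

/-- If a non-increasing function `G` dominates the Stieltjes type integrals of `F`, its averages
dominate both Calderón operators. -/
lemma calderon_le_angle (hp₀ : 1 < p₀) (hq : p₀ < q) (hp₁ : 1 < p₁) (h1 : 1 ≤ q₀) (c : ℝ≥0) :
    ∃ C : ℝ≥0, ∀ (F G : ℝ → ℝ≥0∞) (t : ℝ), Antitone F → 0 < t →
      (∀ s, 0 < s → s ≤ t → stieltjes q F (s ^ slope p₀ p₁ q) ≤ c * G s) →
      ENNReal.ofReal (t ^ (-1 / p₁)) *
          lorentzFunctional p₀ q₀ (Set.Ioc 0 (t ^ slope p₀ p₁ q)) F ≤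
        C * (ENNReal.ofReal (t ^ (-1 / p₁)) * lorentzFunctional p₁ q₀ (Set.Ioc 0 t) G) ∧
      ∫⁻ s in Set.Ioi (t ^ slope p₀ p₁ q), ENNReal.ofReal (s ^ (1 / q - 1)) * F s ≤
        C * (ENNReal.ofReal (t ^ (-1 / p₁)) * lorentzFunctional p₁ q₀ (Set.Ioc 0 t) G) := by
  have hr := slope_pos hp₀ hq hp₁
  have hrel := slope_div hp₀ hq hp₁
  set r := slope p₀ p₁ q
  have hq1 : 1 < q := by linarith
  obtain ⟨κ, hκ⟩ := lorentzFunctional_comp_rpow hr hrel h1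
  obtain ⟨κ₁, hκ₁, hconst⟩ := lorentzFunctional_const (p := p₁) (by linarith) h1
  let d : ℝ≥0 := Real.toNNReal (2 ^ (1 - 1 / q))
  refine ⟨κ * (d * c) + d * κ₁⁻¹ * c, fun F G t hF ht hle => ?_⟩
  set ρ := ENNReal.ofReal (t ^ (-1 / p₁)) with hρ
  set Λ := lorentzFunctional p₁ q₀ (Set.Ioc 0 t) G with hΛ
  have hρt : ρ * ENNReal.ofReal (t ^ (1 / p₁)) = 1 := by
    rw [hρ, ← ENNReal.ofReal_mul (by positivity), ← Real.rpow_add ht]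
    simp [neg_div]
  have hd : ENNReal.ofReal (2 ^ (1 - 1 / q)) = (d : ℝ≥0∞) := rfl
  constructor
  -- After s = u^r the integrand contains u^{r/q} F(u^r), which is a^{1/q} F(a) at a = u^r.
  · have hR : lorentzFunctional p₀ q₀ (Set.Ioc 0 (t ^ r)) F ≤ κ * (d * c * Λ) := by
      refine (hκ t ht F).trans (mul_le_mul_right ?_ _)
      rw [hΛ, ← lorentzFunctional_const_mul h1 _ _ (ENNReal.mul_ne_top ENNReal.coe_ne_top
        ENNReal.coe_ne_top)]
      refine lorentzFunctional_mono h1 measurableSet_Ioc measurableSet_Ioc fun u hu _ => ⟨hu, ?_⟩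
      have hur : 0 < u ^ r := Real.rpow_pos_of_pos hu.1 r
      have h2 := rpow_mul_le_stieltjes hq1 hF hur
      rw [← Real.rpow_mul hu.1.le, mul_one_div, hd] at h2
      refine h2.trans ?_
      rw [mul_assoc]
      gcongr
      exact hle u hu.1 hu.2
    calc _ ≤ ρ * (κ * (d * c * Λ)) := by gcongr
      _ = ((κ * (d * c) : ℝ≥0) : ℝ≥0∞) * (ρ * Λ) := by push_cast; ring
      _ ≤ _ := by gcongr; exact le_self_add
  · have hκΛ : κ₁ * (ENNReal.ofReal (t ^ (1 / p₁)) * stieltjes q F (t ^ r)) ≤ c * Λ := by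
      rw [← hconst t ht, hΛ, ← lorentzFunctional_const_mul h1 _ _ ENNReal.coe_ne_top]
      refine lorentzFunctional_mono h1 measurableSet_Ioc measurableSet_Ioc fun s hs _ => ⟨hs, ?_⟩
      exact (antitoneOn_stieltjes_rpow hq1 F hr hs.1 ht hs.2).trans (hle s hs.1 hs.2)
    have e2 : ((κ₁⁻¹ : ℝ≥0) : ℝ≥0∞) * κ₁ = 1 := by
      rw [← ENNReal.coe_mul, inv_mul_cancel₀ hκ₁, ENNReal.coe_one]
    calc _ ≤ d * stieltjes q F (t ^ r) :=
          setLIntegral_Ioi_le_stieltjes hq1 F (Real.rpow_pos_of_pos ht r)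
      _ = d * (κ₁⁻¹ : ℝ≥0) * (ρ * (κ₁ * (ENNReal.ofReal (t ^ (1 / p₁)) *
            stieltjes q F (t ^ r)))) := by
          calc _ = d * ((((κ₁⁻¹ : ℝ≥0) : ℝ≥0∞) * κ₁) * ((ρ * ENNReal.ofReal (t ^ (1 / p₁))) *
                stieltjes q F (t ^ r))) := by rw [e2, hρt, one_mul, one_mul]
            _ = _ := by ring
      _ ≤ d * (κ₁⁻¹ : ℝ≥0) * (ρ * (c * Λ)) := by gcongr
      _ = ((d * κ₁⁻¹ * c : ℝ≥0) : ℝ≥0∞) * (ρ * Λ) := by push_cast; ring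
      _ ≤ _ := by gcongr; exact le_add_self

/-- Boundedness of all linear operators implies that of the Calderón operators. -/
theorem boundedRep_of_boundedToAngle [SigmaFinite μ] [SigmaFinite ν] (hμ : NonAtomic μ)
    (hν : NonAtomic ν) (hp₀ : 1 < p₀) (hq : p₀ < q) (hp₁ : 1 < p₁) (h1 : 1 ≤ q₀) {X : RINorm μ}
    {Y : RINorm ν}
    (hX : ∀ f : α →ₘ[μ] ℝ, X.norm (fun x => ‖f x‖ₑ) < ∞ → MemSum μ p₀ q q₀ f)
    (hlin : ∀ T : (α →ₘ[μ] ℝ) → (β →ₘ[ν] ℝ), LinearOn (MemSum μ p₀ q q₀) T →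
      EndpointBounded p₀ p₁ q q₀ q₀ T → BoundedToAngle X Y p₁ q₀ T) :
    BoundedRep X Y (calderonR (repMeasure μ) p₀ p₁ q q₀) ∧
      BoundedRep X Y (calderonS (repMeasure μ) p₀ p₁ q) := by
  obtain ⟨σ, hσ⟩ := exists_measurePreserving hμ
  obtain ⟨τ, hτ⟩ := exists_measurePreserving hν
  have hr := slope_pos hp₀ hq hp₁
  have hrel := slope_div hp₀ hq hp₁
  have hq1 : 1 < q := by linarith
  obtain ⟨C, hC⟩ := hlin _ (linearOn_kernelOp hσ hτ hp₀ hq hp₁ hr hrel h1)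
    (endpointBounded_kernelOp hσ hτ hp₀ hq hr hrel h1)
  obtain ⟨D, hD⟩ := calderon_le_angle hp₀ hq hp₁ h1
    (Real.toNNReal ((2 ^ slope p₀ p₁ q) ^ (1 - 1 / q)))
  have key : ∀ f : ℝ → ℝ≥0∞, AEMeasurable f (repMeasure μ) → X.repNorm f < ∞ →
      Y.repNorm (calderonR (repMeasure μ) p₀ p₁ q q₀ f) ≤ (D * C : ℝ≥0) * X.repNorm f ∧
      Y.repNorm (calderonS (repMeasure μ) p₀ p₁ q f) ≤ (D * C : ℝ≥0) * X.repNorm f := by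
    intro f hf hfin
    set F := rearr (repMeasure μ) f with hF
    have hFm : Measurable F := measurable_rearr _ _
    have hFu : F = rearr μ fun x => f (σ x) := (rearr_comp hσ hf).symm
    have hw : AEMeasurable (fun x => F (σ x)) μ := (hFm.comp hσ.measurable).aemeasurable
    have hwr : rearr μ (fun x => F (σ x)) = F := by
      rw [rearr_comp hσ hFm.aemeasurable, hFu, rearr_rearr]
    have hnorm : X.norm (fun x => F (σ x)) = X.repNorm f := by
      rw [repNorm_eq hσ X hf]
      refine X.norm_eq_of_rearr_eq _ _ hw
        (hf.comp_quasiMeasurePreserving hσ.quasiMeasurePreserving) fun t _ => ?_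
      rw [hwr, hFu]
    have hwfin := ae_lt_top_of_norm_lt_top X hw (hnorm ▸ hfin)
    -- The test function is f^* ∘ σ: it has the rearrangement and the norm of f, and it is arranged
    -- so that no cancellation or loss occurs in the kernel operator.
    let g : α →ₘ[μ] ℝ := AEEqFun.mk (fun x => (F (σ x)).toReal) hw.ennreal_toReal.aestronglyMeasurable
    have hg : g =ᵐ[μ] fun x => (F (σ x)).toReal := AEEqFun.coeFn_mk _ _
    have hgF : ∀ᵐ x ∂μ, 0 ≤ g x ∧ ENNReal.ofReal (g x) = F (σ x) := by
      filter_upwards [hg, hwfin] with x hx hx2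
      rw [hx]
      exact ⟨ENNReal.toReal_nonneg, ENNReal.ofReal_toReal hx2.ne⟩
    have hgw : (fun x => ‖g x‖ₑ) =ᵐ[μ] fun x => F (σ x) := by
      filter_upwards [hgF] with x hx
      rw [Real.enorm_eq_ofReal hx.1, hx.2]
    have hgm : AEMeasurable (fun x => ‖g x‖ₑ) μ := g.aestronglyMeasurable.enorm
    have hgnorm : X.norm (fun x => ‖g x‖ₑ) = X.repNorm f := by
      rw [← hnorm]
      exact le_antisymm (X.norm_mono _ _ hgm hw hgw.le) (X.norm_mono _ _ hw hgm hgw.symm.le)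
    have hgfin : X.norm (fun x => ‖g x‖ₑ) < ∞ := hgnorm ▸ hfin
    have hTg := enorm_kernelOp_eq hσ hτ hp₀ hq hp₁ hr hrel h1 hFm
      (fun s hs => by rw [hFu]; exact rearr_eq_zero hs) (hX g hgfin) hgF
    have hbound := hC g hgfin
    set G := rearr ν fun y => ‖kernelOp ν hσ.measurable hτ.measurable q (slope p₀ p₁ q) g y‖ₑ
      with hG
    have hGeq : G = rearr (repMeasure ν) fun t => stieltjes q F (t ^ slope p₀ p₁ q) := by
      rw [← rearr_comp hτ (aemeasurable_stieltjes hq1 hr F)]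
      ext s
      exact le_antisymm (rearr_mono (hTg.mono fun _ h => h.le) s)
        (rearr_mono (hTg.mono fun _ h => h.ge) s)
    -- Only s ≤ t inside the interval (0, ν(β)) matter, which is where `stieltjes_le_rearr` applies.
    have hDt : ∀ t : ℝ, 0 < t → ENNReal.ofReal t < ν Set.univ → _ := fun t ht htν =>
      hD F G t (rearr_antitone _ _) ht fun s hs hst => by
        rw [hGeq]
        exact stieltjes_le_rearr hq1 hr F hs ((ENNReal.ofReal_le_ofReal hst).trans_lt htν)
    have mA := aemeasurable_angle (ν := ν) (p := p₁) h1 G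
    have hfinal : (D : ℝ≥0∞) * Y.repNorm (fun t => ENNReal.ofReal (t ^ (-1 / p₁)) *
        lorentzFunctional p₁ q₀ (Set.Ioc 0 t) G) ≤ (D * C : ℝ≥0) * X.repNorm f := by
      rw [ENNReal.coe_mul, mul_assoc, ← hgnorm]
      gcongr
      exact hbound
    exact ⟨(repNorm_le_mul hτ Y (aemeasurable_calderonR _ h1 hr f) mA D
        fun t ht htν => (hDt t ht htν).1).trans hfinal,
      (repNorm_le_mul hτ Y (aemeasurable_calderonS _ hr f) mA D
        fun t ht htν => (hDt t ht htν).2).trans hfinal⟩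
  exact ⟨⟨D * C, fun f hf hfin => (key f hf hfin).1⟩, ⟨D * C, fun f hf hfin => (key f hf hfin).2⟩⟩

end LowerBound

section LinearQuasilinear

variable {α β : Type*} [MeasurableSpace α] [MeasurableSpace β] {μ : Measure α} {ν : Measure β}

lemma LinearOn.quasilinearOn {D : (α →ₘ[μ] ℝ) → Prop} {T : (α →ₘ[μ] ℝ) → (β →ₘ[ν] ℝ)}
    (hT : LinearOn D T) : QuasilinearOn D T := by
  refine ⟨⟨1, fun f g hf hg => ?_⟩, fun c f hf => ?_⟩
  · rw [hT.1 f g hf hg]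
    filter_upwards [AEEqFun.coeFn_add (T f) (T g)] with y hy
    rw [hy, one_mul]
    exact abs_add_le _ _
  · rw [hT.2 c f hf]
    filter_upwards [AEEqFun.coeFn_smul c (T f)] with y hy
    rw [hy, Pi.smul_apply, smul_eq_mul, abs_mul]

end LinearQuasilinear

end CalderonLorentz

theorem mainTheorem1 {α β : Type*} [MeasurableSpace α] [MeasurableSpace β]
    (μ : Measure α) (ν : Measure β) [SigmaFinite μ] [SigmaFinite ν]
    (hμ : CalderonLorentz.NonAtomic μ) (hν : CalderonLorentz.NonAtomic ν)
    (p₀ p₁ q : ℝ) (q₀ : ℝ≥0∞) (hp₀ : 1 < p₀) (hq : p₀ < q) (hp₁ : 1 < p₁) (hq₀ : 1 ≤ q₀)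
    (X : CalderonLorentz.RINorm μ) (Y : CalderonLorentz.RINorm ν)
    (hX : ∀ f : α →ₘ[μ] ℝ, X.norm (fun x => ‖f x‖ₑ) < ∞ →
      CalderonLorentz.MemSum μ p₀ q q₀ f) :
    List.TFAE [
      ∀ T : (α →ₘ[μ] ℝ) → (β →ₘ[ν] ℝ),
        CalderonLorentz.LinearOn (CalderonLorentz.MemSum μ p₀ q q₀) T →
        CalderonLorentz.EndpointBounded p₀ p₁ q q₀ q₀ T →
        CalderonLorentz.BoundedToAngle X Y p₁ q₀ T,
      ∀ T : (α →ₘ[μ] ℝ) → (β →ₘ[ν] ℝ),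
        CalderonLorentz.QuasilinearOn (CalderonLorentz.MemSum μ p₀ q q₀) T →
        CalderonLorentz.EndpointBounded p₀ p₁ q q₀ q₀ T →
        CalderonLorentz.BoundedToAngle X Y p₁ q₀ T,
      CalderonLorentz.BoundedRep X Y
          (CalderonLorentz.calderonR (CalderonLorentz.repMeasure μ) p₀ p₁ q q₀) ∧
        CalderonLorentz.BoundedRep X Y
          (CalderonLorentz.calderonS (CalderonLorentz.repMeasure μ) p₀ p₁ q)] := by
  tfae_have 2 → 1 := fun h T hT hb => h T hT.quasilinearOn hb
  tfae_have 3 → 2 := fun h T hT hb =>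
    CalderonLorentz.boundedToAngle_of_boundedRep hμ hν hp₀ hq hp₁ hq₀ h.1 h.2 hT hb
  tfae_have 1 → 3 := fun h =>
    CalderonLorentz.boundedRep_of_boundedToAngle hμ hν hp₀ hq hp₁ hq₀ hX h
  tfae_finish
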